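/- Let $\Omega\subset\mathbb R^2$ be a bounded domain with Lipschitz boundary, and let $\Gamma_D,\Gamma_N$ be disjoint relatively open subsets of $\partial\Omega$ such that $\Gamma_D\ne\emptyset$ and $\partial\Omega\setminus(\Gamma_D\cup\Gamma_N)$ is finite. Let $T\in(0,\infty)$. Let $\mathcal E(\overline\Omega)$ be the set of all $\varphi\in C^\infty(\overline\Omega)^2$ with $\operatorname{div}\varphi=0$ in $\Omega$ and $\operatorname{supp}\varphi\cap\overline{\Gamma_D}=\emptyset$, and let $L^2_\kappa$ and $V_\kappa$ be its closures in $L^2(\Omega)^2$ and in $W^{1,2}(\Omega)^2$, respectively. Let $(\cdot,\cdot)$ denote the scalar product of $L^2(\Omega)^2$, and for $\Phi,\Psi,\theta,\psi,\phi\in V_\kappa$ put $$((\Phi,\Psi))=\int_\Omega\nabla\Phi\cdot\nabla\Psi\,dx,\qquad b(\theta,\psi,\phi)=\sum_{i,j=1}^2\int_\Omega\theta_j\,\frac{\partial\psi_i}{\partial x_j}\,\phi_i\,dx .$$ Let $\mathcal D$ be the space of all $w\in V_\kappa$ for which there is an $f\in L^2_\kappa$ with $((w,v))=(f,v)$ for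 all $v\in V_\kappa$, normed by $\|w\|_{\mathcal D}=\|f\|_{L^2}$, and put $$X=\{\varphi\in L^2(0,T;\mathcal D):\ \varphi'\in L^2(0,T;L^2_\kappa)\},\qquad Y=\{[g;\omega]:\ g\in L^2(0,T;L^2_\kappa),\ \omega\in V_\kappa\}.$$ For $u,w\in X$ let $$\mathcal G_u(w)=\Bigl[(w'(t),\cdot)+((w(t),\cdot))+b(u(t),w(t),\cdot)+b(w(t),u(t),\cdot)\,;\ w(0)\Bigr],$$ where the first component is, for almost every $t\in(0,T)$, a functional on $V_\kappa$, and $w(0)$ is the value at $0$ of the continuous representative of $w$. An element $[g;\omega]$ of $Y$ is identified with the pair of $t\mapsto(g(t),\cdot)$ and $\omega\in V_\kappa\subset L^2_\kappa$. Then for every $u\in X$ the operator $\mathcal G_u$ is injective on $X$: if $w_1,w_2\in X$ satisfy $w_1(0)=w_2(0)$ and, for almost every $t\in(0,T)$, the functionals on $V_\kappa$ in the first components of $\mathcal G_u(w_1)$ and $\mathcal G_u(w_2)$ coincide, then $w_1=w_2$. In particular, any operator $X\to Y$ given by the formula for $\mathcal G_u$ is injective. -/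

import Mathlib

open MeasureTheory Set
open scoped ContDiff

noncomputable section

namespace MixedNS

/-- The Euclidean plane. -/
abbrev Plane : Type := EuclideanSpace ℝ (Fin 2)

/-- Real `2 × 2` matrices with the Frobenius (Euclidean) norm. -/
abbrev Mat2 : Type := EuclideanSpace ℝ (Fin 2 × Fin 2)

/-- `Ω` has a Lipschitz boundary (class `C^{0,1}`): near each boundary point it is, in suitable
orthonormal coordinates, the strict epigraph of a Lipschitz function of one variable. -/
def LipschitzBoundary (Ω : Set Plane) : Prop :=
  ∀ x ∈ frontier Ω, ∃ (e : Plane ≃ₗᵢ[ℝ] Plane) (a : ℝ → ℝ) (L : NNReal) (r : ℝ),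
    LipschitzWith L a ∧ 0 < r ∧
      ∀ y ∈ Metric.ball x r, y ∈ Ω ↔ a (e y 0) < e y 1

/-- `Ω ⊆ ℝ²` is a bounded Lipschitz domain whose boundary consists of two disjoint, relatively open
parts `ΓD ≠ ∅` and `ΓN` and of finitely many further points. -/
structure IsMixedDomain (Ω ΓD ΓN : Set Plane) : Prop where
  isOpen : IsOpen Ω
  isConnected : IsConnected Ω
  isBounded : Bornology.IsBounded Ω
  lipschitz : LipschitzBoundary Ω
  relOpen_D : ∃ U : Set Plane, IsOpen U ∧ ΓD = U ∩ frontier Ω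
  relOpen_N : ∃ U : Set Plane, IsOpen U ∧ ΓN = U ∩ frontier Ω
  disjoint : Disjoint ΓD ΓN
  nonempty_D : ΓD.Nonempty
  finite_rest : (frontier Ω \ (ΓD ∪ ΓN)).Finite

/-- The Jacobian matrix of `φ`; the entry `(i, j)` is `∂φ_i / ∂x_j`. -/
def jacobian (φ : Plane → Plane) (x : Plane) : Mat2 :=
  WithLp.toLp 2 fun p => fderiv ℝ φ x (EuclideanSpace.single p.2 1) p.1

/-- `φ` represents an element of `𝓔(Ω̄)`: it is smooth up to the boundary (the restriction of a
smooth map on the plane), divergence free in `Ω`, and its support in `Ω̄` does not meet the closure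
of `ΓD`. -/
structure IsTestField (Ω ΓD : Set Plane) (φ : Plane → Plane) : Prop where
  smooth : ContDiff ℝ ∞ φ
  div_free : ∀ x ∈ Ω, ∑ i : Fin 2, jacobian φ x (i, i) = 0
  supp : Disjoint (closure {x | x ∈ closure Ω ∧ φ x ≠ 0}) (closure ΓD)

/-- `L²(Ω)²`. -/
abbrev L2 (Ω : Set Plane) : Type := Lp Plane 2 (volume.restrict Ω)

/-- `L²(Ω)^{2×2}`. -/
abbrev L2Mat (Ω : Set Plane) : Type := Lp Mat2 2 (volume.restrict Ω)

lemma jacobian_add {φ ψ : Plane → Plane} (hφ : ContDiff ℝ ∞ φ) (hψ : ContDiff ℝ ∞ ψ)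
    (x : Plane) : jacobian (φ + ψ) x = jacobian φ x + jacobian ψ x := by
  ext p
  have h1 : DifferentiableAt ℝ φ x := (hφ.differentiable (by simp)) x
  have h2 : DifferentiableAt ℝ ψ x := (hψ.differentiable (by simp)) x
  simp [jacobian, fderiv_add h1 h2]

lemma jacobian_smul (c : ℝ) {φ : Plane → Plane} (hφ : ContDiff ℝ ∞ φ)
    (x : Plane) : jacobian (c • φ) x = c • jacobian φ x := by
  ext p
  have h1 : DifferentiableAt ℝ φ x := (hφ.differentiable (by simp)) x
  simp [jacobian, fderiv_const_smul h1 c]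

lemma jacobian_zero (x : Plane) : jacobian 0 x = 0 := by
  ext p
  simp [jacobian]

variable {Ω ΓD : Set Plane}

lemma IsTestField.zero : IsTestField Ω ΓD 0 where
  smooth := contDiff_const
  div_free x _ := by simp [jacobian_zero]
  supp := by simp

lemma IsTestField.add {φ ψ : Plane → Plane} (hφ : IsTestField Ω ΓD φ) (hψ : IsTestField Ω ΓD ψ) :
    IsTestField Ω ΓD (φ + ψ) where
  smooth := hφ.smooth.add hψ.smooth
  div_free x hx := by
    have h1 := hφ.div_free x hx
    have h2 := hψ.div_free x hx
    simp only [jacobian_add hφ.smooth hψ.smooth, PiLp.add_apply, Finset.sum_add_distrib, h1, h2,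
      add_zero]
  supp := by
    refine Disjoint.mono_left ?_ (Disjoint.union_left hφ.supp hψ.supp)
    rw [← closure_union]
    refine closure_mono fun x hx => ?_
    by_cases h : φ x = 0
    · exact Or.inr ⟨hx.1, fun h' => hx.2 (by simp [h, h'])⟩
    · exact Or.inl ⟨hx.1, h⟩

lemma IsTestField.smul (c : ℝ) {φ : Plane → Plane} (hφ : IsTestField Ω ΓD φ) :
    IsTestField Ω ΓD (c • φ) where
  smooth := contDiff_const.smul hφ.smooth
  div_free x hx := by
    have h1 := hφ.div_free x hx
    simp only [jacobian_smul c hφ.smooth, PiLp.smul_apply, ← Finset.smul_sum, h1, smul_zero]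
  supp := by
    have hs : {x | x ∈ closure Ω ∧ (c • φ) x ≠ 0} ⊆ {x | x ∈ closure Ω ∧ φ x ≠ 0} :=
      fun x hx => ⟨hx.1, fun h' => hx.2 (by simp [h'])⟩
    exact Disjoint.mono_left (closure_mono hs) hφ.supp

variable (Ω ΓD)

/-- `𝓔(Ω̄)`, as a subspace of `L²(Ω)²`. -/
def testL2 : Submodule ℝ (L2 Ω) where
  carrier := {f | ∃ φ, IsTestField Ω ΓD φ ∧ f =ᵐ[volume.restrict Ω] φ}
  zero_mem' := ⟨0, .zero, Lp.coeFn_zero _ _ _⟩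
  add_mem' := by
    rintro f g ⟨φ, hφ, hf⟩ ⟨ψ, hψ, hg⟩
    exact ⟨φ + ψ, hφ.add hψ, (Lp.coeFn_add f g).trans (hf.add hg)⟩
  smul_mem' := by
    rintro c f ⟨φ, hφ, hf⟩
    exact ⟨c • φ, hφ.smul c, (Lp.coeFn_smul c f).trans (hf.const_smul c)⟩

/-- `𝓔(Ω̄)`, embedded by `φ ↦ (φ, ∇φ)` into `L²(Ω)² × L²(Ω)^{2×2}` with its Hilbert norm, which
restricts to the norm of `W^{1,2}(Ω)²`. -/
def testW12 : Submodule ℝ (WithLp 2 (L2 Ω × L2Mat Ω)) where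
  carrier := {p | ∃ φ, IsTestField Ω ΓD φ ∧ p.fst =ᵐ[volume.restrict Ω] φ ∧
    p.snd =ᵐ[volume.restrict Ω] jacobian φ}
  zero_mem' := by
    refine ⟨0, .zero, Lp.coeFn_zero _ _ _, (Lp.coeFn_zero _ _ _).trans ?_⟩
    exact Filter.Eventually.of_forall fun x => (jacobian_zero x).symm
  add_mem' := by
    rintro p q ⟨φ, hφ, hp, hp'⟩ ⟨ψ, hψ, hq, hq'⟩
    refine ⟨φ + ψ, hφ.add hψ, (Lp.coeFn_add p.fst q.fst).trans (hp.add hq),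
      (Lp.coeFn_add p.snd q.snd).trans ((hp'.add hq').trans ?_)⟩
    exact Filter.Eventually.of_forall fun x => (jacobian_add hφ.smooth hψ.smooth x).symm
  smul_mem' := by
    rintro c p ⟨φ, hφ, hp, hp'⟩
    refine ⟨c • φ, hφ.smul c, (Lp.coeFn_smul c p.fst).trans (hp.const_smul c),
      (Lp.coeFn_smul c p.snd).trans ((hp'.const_smul c).trans ?_)⟩
    exact Filter.Eventually.of_forall fun x => (jacobian_smul c hφ.smooth x).symm

/-- `L²_κ`, the closure of `𝓔(Ω̄)` in `L²(Ω)²`, with the norm of `L²(Ω)²`. -/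
def LKappa : Type := (testL2 Ω ΓD).topologicalClosure

instance : NormedAddCommGroup (LKappa Ω ΓD) :=
  inferInstanceAs (NormedAddCommGroup (testL2 Ω ΓD).topologicalClosure)

instance : InnerProductSpace ℝ (LKappa Ω ΓD) :=
  inferInstanceAs (InnerProductSpace ℝ (testL2 Ω ΓD).topologicalClosure)

instance : CompleteSpace (LKappa Ω ΓD) :=
  inferInstanceAs (CompleteSpace (testL2 Ω ΓD).topologicalClosure)

/-- `V_κ`, the closure of `𝓔(Ω̄)` in `W^{1,2}(Ω)²`, with the norm of `W^{1,2}(Ω)²`. An element is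
stored as the pair of the function and its weak gradient (the second is determined by the first). -/
def VKappa : Type := (testW12 Ω ΓD).topologicalClosure

instance : NormedAddCommGroup (VKappa Ω ΓD) :=
  inferInstanceAs (NormedAddCommGroup (testW12 Ω ΓD).topologicalClosure)

instance : InnerProductSpace ℝ (VKappa Ω ΓD) :=
  inferInstanceAs (InnerProductSpace ℝ (testW12 Ω ΓD).topologicalClosure)

instance : CompleteSpace (VKappa Ω ΓD) :=
  inferInstanceAs (CompleteSpace (testW12 Ω ΓD).topologicalClosure)

variable {Ω ΓD}

/-- The inclusion `L²_κ ⊆ L²(Ω)²`. -/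
def LKappa.fn : LKappa Ω ΓD →ₗ[ℝ] L2 Ω := (testL2 Ω ΓD).topologicalClosure.subtype

/-- The function underlying an element of `V_κ` belongs to `L²_κ`. -/
lemma fst_mem_of_mem_closure (v : (testW12 Ω ΓD).topologicalClosure) :
    v.1.fst ∈ (testL2 Ω ΓD).topologicalClosure := by
  have hc : Continuous fun p : WithLp 2 (L2 Ω × L2Mat Ω) => p.fst := WithLp.continuous_fst 2 _ _
  have hm : MapsTo (fun p : WithLp 2 (L2 Ω × L2Mat Ω) => p.fst) (testW12 Ω ΓD) (testL2 Ω ΓD) :=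
    fun p ⟨φ, hφ, h, _⟩ => ⟨φ, hφ, h⟩
  exact hm.closure hc v.2

/-- The function underlying an element of `V_κ`, that is, the inclusion `V_κ ⊆ L²_κ`. -/
def VKappa.toLKappa : VKappa Ω ΓD →ₗ[ℝ] LKappa Ω ΓD where
  toFun v := ⟨v.1.fst, fst_mem_of_mem_closure v⟩
  map_add' _ _ := rfl
  map_smul' _ _ := rfl

/-- The weak gradient of an element of `V_κ`; the entry `(i, j)` is `∂v_i / ∂x_j`. -/
def VKappa.grad : VKappa Ω ΓD →ₗ[ℝ] L2Mat Ω where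
  toFun v := v.1.snd
  map_add' _ _ := rfl
  map_smul' _ _ := rfl

/-- Integration by parts against a test function. -/
lemma integral_jacobian_by_parts {φ : Plane → Plane} {η : Plane → ℝ} (hφ : ContDiff ℝ ∞ φ)
    (hη : ContDiff ℝ ∞ η) (hηc : HasCompactSupport η) (hηs : tsupport η ⊆ Ω) (i j : Fin 2) :
    ∫ x in Ω, η x * jacobian φ x (i, j) =
      -∫ x in Ω, fderiv ℝ η x (EuclideanSpace.single j 1) * φ x i := by
  have hη' : Continuous fun x => fderiv ℝ η x (EuclideanSpace.single j 1) :=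
    (hη.continuous_fderiv (by simp)).clm_apply continuous_const
  have hηc' : HasCompactSupport fun x => fderiv ℝ η x (EuclideanSpace.single j 1) :=
    hηc.fderiv_apply ℝ _
  have c1 : Continuous fun x => fderiv ℝ φ x (EuclideanSpace.single j 1) i :=
    (EuclideanSpace.proj (𝕜 := ℝ) i).continuous.comp
      ((hφ.continuous_fderiv (by simp)).clm_apply continuous_const)
  have c2 : Continuous fun x => φ x i :=
    (EuclideanSpace.proj (𝕜 := ℝ) i).continuous.comp hφ.continuous
  have dφ : Differentiable ℝ φ := hφ.differentiable (by simp)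
  have hd : ∀ x, fderiv ℝ (fun y => φ y i) x (EuclideanSpace.single j 1) =
      fderiv ℝ φ x (EuclideanSpace.single j 1) i := by
    intro x
    have h2 := (EuclideanSpace.proj (𝕜 := ℝ) i).hasFDerivAt.comp x (dφ x).hasFDerivAt
    exact congrArg (fun A => A (EuclideanSpace.single j 1)) h2.fderiv
  have dφi : Differentiable ℝ fun y => φ y i := fun x =>
    (EuclideanSpace.proj (𝕜 := ℝ) i).differentiableAt.comp x (dφ x)
  rw [setIntegral_eq_integral_of_forall_compl_eq_zero (s := Ω),
    setIntegral_eq_integral_of_forall_compl_eq_zero (s := Ω)]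
  · have hI := integral_mul_fderiv_eq_neg_fderiv_mul_of_integrable (μ := volume)
      (f := η) (g := fun y => φ y i) (v := EuclideanSpace.single j (1 : ℝ))
      ((hη'.mul c2).integrable_of_hasCompactSupport hηc'.mul_right)
      (by
        simp only [hd]
        exact (hη.continuous.mul c1).integrable_of_hasCompactSupport hηc.mul_right)
      ((hη.continuous.mul c2).integrable_of_hasCompactSupport hηc.mul_right)
      (fun x _ => (hη.differentiable (by simp)) x) (fun x _ => dφi x)
    simp only [hd] at hI
    exact hI
  · intro x hx
    have : fderiv ℝ η x = 0 := image_eq_zero_of_notMem_tsupport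
      fun h => hx (hηs (tsupport_fderiv_subset ℝ h))
    simp [this]
  · intro x hx
    rw [image_eq_zero_of_notMem_tsupport (fun h => hx (hηs h)), zero_mul]

/-- An element of `V_κ` is determined by its underlying function. -/
lemma VKappa.toLKappa_injective (hΩ : IsOpen Ω) :
    Function.Injective (VKappa.toLKappa : VKappa Ω ΓD → LKappa Ω ΓD) := by
  refine (injective_iff_map_eq_zero VKappa.toLKappa).2 fun v hv => ?_
  have hv1 : v.1.fst = 0 := congrArg LKappa.fn hv
  suffices h : v.1.snd = 0 from Subtype.ext (WithLp.ofLp_injective 2 (Prod.ext hv1 h))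
  have key : ∀ (i j : Fin 2) (η : Plane → ℝ), ContDiff ℝ ∞ η → HasCompactSupport η →
      tsupport η ⊆ Ω → ∫ x in Ω, η x * v.1.snd x (i, j) = 0 := by
    intro i j η hη hηc hηs
    have hη' : Continuous fun x => fderiv ℝ η x (EuclideanSpace.single j 1) :=
      (hη.continuous_fderiv (by simp)).clm_apply continuous_const
    have hηc' : HasCompactSupport fun x => fderiv ℝ η x (EuclideanSpace.single j 1) :=
      hηc.fderiv_apply ℝ _
    have m1 : MemLp (fun x => η x • (EuclideanSpace.single (i, j) 1 : Mat2)) 2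
        (volume.restrict Ω) :=
      ((hη.continuous.smul continuous_const).memLp_of_hasCompactSupport
        hηc.smul_right).restrict Ω
    have m2 : MemLp (fun x => fderiv ℝ η x (EuclideanSpace.single j 1) •
        (EuclideanSpace.single i 1 : Plane)) 2 (volume.restrict Ω) :=
      ((hη'.smul continuous_const).memLp_of_hasCompactSupport hηc'.smul_right).restrict Ω
    have e1 : ∀ f : L2Mat Ω, inner ℝ (m1.toLp _) f = ∫ x in Ω, η x * f x (i, j) := by
      intro f
      rw [L2.inner_def]
      refine integral_congr_ae ?_
      filter_upwards [m1.coeFn_toLp] with x hx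
      rw [hx, real_inner_smul_left, EuclideanSpace.inner_single_left]
      simp
    have e2 : ∀ f : L2 Ω, inner ℝ (m2.toLp _) f =
        ∫ x in Ω, fderiv ℝ η x (EuclideanSpace.single j 1) * f x i := by
      intro f
      rw [L2.inner_def]
      refine integral_congr_ae ?_
      filter_upwards [m2.coeFn_toLp] with x hx
      rw [hx, real_inner_smul_left, EuclideanSpace.inner_single_left]
      simp
    generalize m1.toLp _ = Ψ₁ at e1
    generalize m2.toLp _ = Ψ₂ at e2
    have hc1 : Continuous fun p : WithLp 2 (L2 Ω × L2Mat Ω) =>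
        inner ℝ Ψ₁ p.snd + inner ℝ Ψ₂ p.fst :=
      (continuous_const.inner (WithLp.continuous_snd 2 _ _)).add
        (continuous_const.inner (WithLp.continuous_fst 2 _ _))
    have hz : (testW12 Ω ΓD : Set (WithLp 2 (L2 Ω × L2Mat Ω))) ⊆
        {p | inner ℝ Ψ₁ p.snd + inner ℝ Ψ₂ p.fst = 0} := by
      rintro p ⟨φ, hφ, hp1, hp2⟩
      have hI := integral_jacobian_by_parts hφ.smooth hη hηc hηs i j
      have f1 : ∫ x in Ω, η x * p.snd x (i, j) = ∫ x in Ω, η x * jacobian φ x (i, j) := by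
        refine integral_congr_ae ?_
        filter_upwards [hp2] with x hx
        rw [hx]
      have f2 : ∫ x in Ω, fderiv ℝ η x (EuclideanSpace.single j 1) * p.fst x i =
          ∫ x in Ω, fderiv ℝ η x (EuclideanSpace.single j 1) * φ x i := by
        refine integral_congr_ae ?_
        filter_upwards [hp1] with x hx
        rw [hx]
      rw [mem_ofPred_eq, e1, e2, f1, f2, hI, neg_add_cancel]
    have hz' : inner ℝ Ψ₁ v.1.snd + inner ℝ Ψ₂ v.1.fst = 0 :=
      closure_minimal hz (isClosed_eq hc1 continuous_const) v.2
    rw [hv1, inner_zero_right, add_zero, e1] at hz'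
    exact hz'
  have hcomp : ∀ p : Fin 2 × Fin 2, ∀ᵐ x ∂volume.restrict Ω, v.1.snd x p = 0 := by
    rintro ⟨i, j⟩
    rw [ae_restrict_iff' hΩ.measurableSet]
    have hm : MemLp (fun x => v.1.snd x (i, j)) 2 (volume.restrict Ω) :=
      (EuclideanSpace.proj (𝕜 := ℝ) (i, j)).comp_memLp' (Lp.memLp v.1.snd)
    refine hΩ.ae_eq_zero_of_integral_contDiff_smul_eq_zero
      (f := fun x => v.1.snd x (i, j)) ?_ ?_
    · rw [locallyIntegrableOn_iff hΩ.isLocallyClosed]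
      intro k hk hkc
      have hmk : MemLp (fun x => v.1.snd x (i, j)) 2 (volume.restrict k) :=
        hm.mono_measure (Measure.restrict_mono hk le_rfl)
      have : IsFiniteMeasure ((volume : Measure Plane).restrict k) :=
        ⟨by simpa using hkc.measure_lt_top⟩
      exact hmk.integrable (by norm_num)
    · intro η hη hηc hηs
      rw [← key i j η hη hηc hηs]
      refine (setIntegral_eq_integral_of_forall_compl_eq_zero fun x hx => ?_).symm
      rw [image_eq_zero_of_notMem_tsupport (fun h => hx (hηs h)), zero_smul]
  refine Lp.ext ?_
  filter_upwards [ae_all_iff.2 hcomp, Lp.coeFn_zero Mat2 2 (volume.restrict Ω)] with x hx h0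
  rw [h0]
  ext p
  exact hx p

/-- The scalar product `((Φ, Ψ)) = ∫_Ω ∇Φ · ∇Ψ`. -/
def gradInner (w v : VKappa Ω ΓD) : ℝ :=
  ∫ x in Ω, ∑ i : Fin 2, ∑ j : Fin 2, w.grad x (i, j) * v.grad x (i, j)

/-- The trilinear form `b(θ, ψ, φ) = ∫_Ω θ_j (∂ψ_i / ∂x_j) φ_i`. -/
def triForm (θ ψ φ : VKappa Ω ΓD) : ℝ :=
  ∫ x in Ω, ∑ i : Fin 2, ∑ j : Fin 2,
    θ.toLKappa.fn x j * ψ.grad x (i, j) * φ.toLKappa.fn x i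

lemma gradInner_eq (w v : VKappa Ω ΓD) : gradInner w v = inner ℝ w.grad v.grad := by
  rw [L2.inner_def, gradInner]
  refine integral_congr_ae (Filter.Eventually.of_forall fun x => ?_)
  change _ = inner ℝ _ _
  rw [PiLp.inner_apply, Fintype.sum_prod_type]
  exact Finset.sum_congr rfl fun i _ => Finset.sum_congr rfl fun j _ => mul_comm _ _

variable (Ω ΓD)

/-- The pairs `(w, f) ∈ V_κ × L²_κ` with `((w, v)) = (f, v)` for all `v ∈ V_κ`. -/
def dGraph : Submodule ℝ (VKappa Ω ΓD × LKappa Ω ΓD) where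
  carrier := {p | ∀ v : VKappa Ω ΓD, gradInner p.1 v = inner ℝ p.2 v.toLKappa}
  zero_mem' v := by simp [gradInner_eq]
  add_mem' := by
    intro p q hp hq v
    have h1 := hp v
    have h2 := hq v
    rw [gradInner_eq] at h1 h2 ⊢
    simp [inner_add_left, h1, h2]
  smul_mem' := by
    intro c p hp v
    have h1 := hp v
    rw [gradInner_eq] at h1 ⊢
    simp [inner_smul_left, h1]

/-- The space `𝒟` of those `w ∈ V_κ` for which there is `f ∈ L²_κ` with `((w, v)) = (f, v)` for all
`v ∈ V_κ`. An element is stored as the pair `(w, f)` (`w` and `f` determine each other), and the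
norm of the graph, which this space carries, is equivalent to `‖f‖` by the Poincaré inequality. -/
def DSpace : Type := dGraph Ω ΓD

instance : NormedAddCommGroup (DSpace Ω ΓD) :=
  inferInstanceAs (NormedAddCommGroup (dGraph Ω ΓD))

instance : NormedSpace ℝ (DSpace Ω ΓD) :=
  inferInstanceAs (NormedSpace ℝ (dGraph Ω ΓD))

variable {Ω ΓD} in
/-- The inclusion `𝒟 ⊆ V_κ`. -/
def DSpace.toVKappa : DSpace Ω ΓD →ₗ[ℝ] VKappa Ω ΓD where
  toFun p := p.1.1
  map_add' _ _ := rfl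
  map_smul' _ _ := rfl

/-- Lebesgue measure on the time interval `(0, T)`. -/
abbrev timeMeasure (T : ℝ) : Measure ℝ := volume.restrict (Ioo 0 T)

/-- `L²(0, T; 𝒟)`. -/
abbrev L2D (T : ℝ) : Type := Lp (DSpace Ω ΓD) 2 (timeMeasure T)

/-- `L²(0, T; L²_κ)`. -/
abbrev L2LKappa (T : ℝ) : Type := Lp (LKappa Ω ΓD) 2 (timeMeasure T)

variable {Ω ΓD}

/-- `φ` has the time derivative `g` and the initial value `ξ`: almost everywhere on `(0, T)` it
agrees with the absolutely continuous function `t ↦ ξ + ∫₀ᵗ g(s) ds` with values in `L²_κ`. -/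
def HasTimeDeriv {T : ℝ} (φ : L2D Ω ΓD T) (g : L2LKappa Ω ΓD T) (ξ : LKappa Ω ΓD) : Prop :=
  ∀ᵐ t ∂timeMeasure T, (φ t).toVKappa.toLKappa = ξ + ∫ s in Ioo 0 t, g s

lemma integrableOn_time {T t : ℝ} (ht : t ∈ Ioo 0 T) (g : L2LKappa Ω ΓD T) :
    IntegrableOn (fun s => g s) (Ioo 0 t) := by
  have h : Integrable (fun s => g s) (timeMeasure T) := (Lp.memLp g).integrable (by norm_num)
  exact IntegrableOn.mono_set h (Ioo_subset_Ioo_right ht.2.le)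

lemma restrict_time_le {T t : ℝ} (ht : t ∈ Ioo 0 T) :
    (volume : Measure ℝ).restrict (Ioo 0 t) ≤ timeMeasure T :=
  Measure.restrict_mono (Ioo_subset_Ioo_right ht.2.le) le_rfl

lemma HasTimeDeriv.zero {T : ℝ} : HasTimeDeriv (0 : L2D Ω ΓD T) 0 0 := by
  filter_upwards [Lp.coeFn_zero (DSpace Ω ΓD) 2 (timeMeasure T),
    ae_restrict_mem measurableSet_Ioo] with t ht htm
  have : ∫ s in Ioo 0 t, (0 : L2LKappa Ω ΓD T) s = 0 :=
    integral_eq_zero_of_ae (ae_mono (restrict_time_le htm) (Lp.coeFn_zero _ _ _))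
  rw [ht, this]
  simp

lemma HasTimeDeriv.add {T : ℝ} {φ ψ : L2D Ω ΓD T} {g h : L2LKappa Ω ΓD T} {ξ η : LKappa Ω ΓD}
    (hφ : HasTimeDeriv φ g ξ) (hψ : HasTimeDeriv ψ h η) :
    HasTimeDeriv (φ + ψ) (g + h) (ξ + η) := by
  filter_upwards [hφ, hψ, Lp.coeFn_add φ ψ, ae_restrict_mem measurableSet_Ioo]
    with t h1 h2 h3 htm
  have h4 : ∫ s in Ioo 0 t, (g + h) s = (∫ s in Ioo 0 t, g s) + ∫ s in Ioo 0 t, h s := by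
    rw [← integral_add (integrableOn_time htm g) (integrableOn_time htm h)]
    exact integral_congr_ae (ae_mono (restrict_time_le htm) (Lp.coeFn_add g h))
  rw [h3, h4, Pi.add_apply, map_add, map_add, h1, h2]
  abel

lemma HasTimeDeriv.smul {T : ℝ} (c : ℝ) {φ : L2D Ω ΓD T} {g : L2LKappa Ω ΓD T} {ξ : LKappa Ω ΓD}
    (hφ : HasTimeDeriv φ g ξ) : HasTimeDeriv (c • φ) (c • g) (c • ξ) := by
  filter_upwards [hφ, Lp.coeFn_smul c φ, ae_restrict_mem measurableSet_Ioo] with t h1 h3 htm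
  have h4 : ∫ s in Ioo 0 t, (c • g) s = c • ∫ s in Ioo 0 t, g s := by
    rw [← integral_smul]
    exact integral_congr_ae (ae_mono (restrict_time_le htm) (Lp.coeFn_smul c g))
  rw [h3, h4, Pi.smul_apply, map_smul, map_smul, h1, smul_add]

/-- The time derivative and the initial value are unique. -/
lemma HasTimeDeriv.unique {T : ℝ} (hT : 0 < T) {φ : L2D Ω ΓD T} {g g' : L2LKappa Ω ΓD T}
    {ξ ξ' : LKappa Ω ΓD} (h : HasTimeDeriv φ g ξ) (h' : HasTimeDeriv φ g' ξ') :
    g = g' ∧ ξ = ξ' := by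
  set k : ℝ → LKappa Ω ΓD := (Ioo 0 T).indicator (fun s => g s - g' s) with hk
  have hg : Integrable (fun s => g s) (timeMeasure T) := (Lp.memLp g).integrable (by norm_num)
  have hg' : Integrable (fun s => g' s) (timeMeasure T) := (Lp.memLp g').integrable (by norm_num)
  have hki : Integrable k := (integrable_indicator_iff measurableSet_Ioo).2 (hg.sub hg')
  have hF : Continuous fun t => ∫ s in (0 : ℝ)..t, k s :=
    intervalIntegral.continuous_primitive (fun a b => hki.intervalIntegrable) 0
  have hae : (fun t => ∫ s in (0 : ℝ)..t, k s) =ᵐ[volume.restrict (Ioo 0 T)]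
      fun _ => ξ' - ξ := by
    filter_upwards [h, h', ae_restrict_mem measurableSet_Ioo] with t h1 h2 ht
    have h3 : ∫ s in (0 : ℝ)..t, k s = ∫ s in Ioo 0 t, (g s - g' s) := by
      rw [intervalIntegral.integral_of_le ht.1.le, integral_Ioc_eq_integral_Ioo]
      refine setIntegral_congr_fun measurableSet_Ioo fun s hs => ?_
      exact indicator_of_mem (show s ∈ Ioo 0 T from ⟨hs.1, hs.2.trans ht.2⟩) _
    rw [h3, integral_sub (integrableOn_time ht g) (integrableOn_time ht g')]
    have h4 := h1.symm.trans h2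
    rw [← sub_eq_zero] at h4 ⊢
    rw [← h4]
    abel
  have hon : EqOn (fun t => ∫ s in (0 : ℝ)..t, k s) (fun _ => ξ' - ξ) (Ioo 0 T) :=
    Measure.eqOn_open_of_ae_eq hae isOpen_Ioo hF.continuousOn continuousOn_const
  have h0 : (∫ s in (0 : ℝ)..0, k s) = ξ' - ξ := by
    have := hon.closure hF continuous_const
    rw [closure_Ioo hT.ne] at this
    exact this ⟨le_rfl, hT.le⟩
  have hξ : ξ = ξ' := by
    rw [intervalIntegral.integral_same] at h0
    exact (sub_eq_zero.1 h0.symm).symm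
  refine ⟨Lp.ext ?_, hξ⟩
  rw [Filter.EventuallyEq, ae_restrict_iff' measurableSet_Ioo]
  filter_upwards [LocallyIntegrable.ae_hasDerivAt_integral hki.locallyIntegrable] with t ht htm
  have h1 : HasDerivAt (fun t => ∫ s in (0 : ℝ)..t, k s) 0 t := by
    refine (hasDerivAt_const t (ξ' - ξ)).congr_of_eventuallyEq ?_
    filter_upwards [isOpen_Ioo.mem_nhds htm] with s hs using hon hs
  have h2 := (ht 0).unique h1
  rw [hk, indicator_of_mem htm] at h2
  exact sub_eq_zero.1 h2

variable (Ω ΓD)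

/-- The space `X` of all `φ ∈ L²(0, T; 𝒟)` with `φ' ∈ L²(0, T; L²_κ)`. -/
def xSubmodule (T : ℝ) : Submodule ℝ (L2D Ω ΓD T) where
  carrier := {φ | ∃ g ξ, HasTimeDeriv φ g ξ}
  zero_mem' := ⟨0, 0, .zero⟩
  add_mem' := by
    rintro φ ψ ⟨g, ξ, h⟩ ⟨g', ξ', h'⟩
    exact ⟨g + g', ξ + ξ', h.add h'⟩
  smul_mem' := by
    rintro c φ ⟨g, ξ, h⟩
    exact ⟨c • g, c • ξ, h.smul c⟩

/-- The space `X` as a type. -/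
abbrev XSpace (T : ℝ) : Type := xSubmodule Ω ΓD T

/-- The space `Y = L²(0, T; L²_κ) × V_κ` of data `[g; ω]`. -/
abbrev YSpace (T : ℝ) : Type := L2LKappa Ω ΓD T × VKappa Ω ΓD

/-- Pairs of a function from `(0, T)` to functionals on `V_κ`, up to equality almost everywhere,
and an element of `L²_κ`. It contains `Y`, see `YSpace.toData`. -/
abbrev DataSpace (T : ℝ) : Type :=
  (ae (timeMeasure T)).Germ (VKappa Ω ΓD → ℝ) × LKappa Ω ΓD

variable {Ω ΓD} {T : ℝ}

/-- The value `φ(t) ∈ V_κ` (in fact in `𝒟`), for almost every `t`. -/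
def XSpace.val (φ : XSpace Ω ΓD T) (t : ℝ) : VKappa Ω ΓD := (φ.1 t).toVKappa

/-- The time derivative `φ' ∈ L²(0, T; L²_κ)`. -/
def XSpace.deriv (φ : XSpace Ω ΓD T) : L2LKappa Ω ΓD T := φ.2.choose

/-- The initial value `φ(0)`, that is, the value at `0` of the continuous representative. -/
def XSpace.init (φ : XSpace Ω ΓD T) : LKappa Ω ΓD := φ.2.choose_spec.choose

/-- `[g; ω] ∈ Y` as an element of `DataSpace`: `g(t) ∈ L²_κ` acts on `V_κ` by `v ↦ (g(t), v)`. -/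
def YSpace.toData (y : YSpace Ω ΓD T) : DataSpace Ω ΓD T :=
  (Filter.Germ.ofFun fun t v => inner ℝ (y.1 t) v.toLKappa, y.2.toLKappa)

/-- A function in `L²_κ` orthogonal to `V_κ` is zero. -/
lemma LKappa.eq_zero_of_orthogonal (hb : Bornology.IsBounded Ω) (f : LKappa Ω ΓD)
    (h : ∀ v : VKappa Ω ΓD, inner ℝ f v.toLKappa = 0) : f = 0 := by
  have h1 : (testL2 Ω ΓD : Set (L2 Ω)) ⊆ {q | inner ℝ f.1 q = 0} := by
    rintro q ⟨φ, hφ, hq⟩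
    have hc : Continuous (jacobian φ) := by
      refine (PiLp.continuous_toLp 2 _).comp (continuous_pi fun p => ?_)
      exact (PiLp.continuous_apply 2 _ p.1).comp
        ((hφ.smooth.continuous_fderiv (by simp)).clm_apply continuous_const)
    have hm : MemLp (jacobian φ) 2 (volume.restrict Ω) := by
      have : IsFiniteMeasure ((volume : Measure Plane).restrict Ω) :=
        ⟨by simpa using hb.measure_lt_top⟩
      obtain ⟨C, hC⟩ := (hb.isCompact_closure.image hc).isBounded.exists_norm_le
      refine MemLp.of_bound hc.aestronglyMeasurable C ?_
      refine ae_restrict_of_ae_restrict_of_subset subset_closure ?_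
      exact ae_restrict_of_forall_mem isClosed_closure.measurableSet fun x hx =>
        hC _ (mem_image_of_mem _ hx)
    have hv : WithLp.toLp 2 (q, hm.toLp _) ∈ testW12 Ω ΓD := ⟨φ, hφ, hq, hm.coeFn_toLp⟩
    exact h ⟨_, (testW12 Ω ΓD).le_topologicalClosure hv⟩
  have h2 : inner ℝ f.1 f.1 = 0 :=
    closure_minimal h1
      (isClosed_eq (continuous_const.inner continuous_id) continuous_const) f.2
  exact Subtype.ext (inner_self_eq_zero.1 h2)

/-- `Y` is contained in `DataSpace`. -/
lemma YSpace.toData_injective (ho : IsOpen Ω) (hb : Bornology.IsBounded Ω) :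
    Function.Injective (YSpace.toData : YSpace Ω ΓD T → DataSpace Ω ΓD T) := by
  rintro ⟨g, y⟩ ⟨g', y'⟩ h
  obtain ⟨h1, h2⟩ := Prod.ext_iff.1 h
  refine Prod.ext (Lp.ext ?_) (VKappa.toLKappa_injective ho h2)
  filter_upwards [Filter.Germ.coe_eq.1 h1] with t ht
  refine sub_eq_zero.1 (LKappa.eq_zero_of_orthogonal hb _ fun v => ?_)
  rw [inner_sub_left, sub_eq_zero]
  exact congrFun ht v

/-- `𝓢(w) = [(w', ·) + ((w, ·)); w(0)]`. -/
def stokesOp (w : XSpace Ω ΓD T) : DataSpace Ω ΓD T :=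
  (Filter.Germ.ofFun fun t v =>
    inner ℝ (w.deriv t) v.toLKappa + gradInner (w.val t) v, w.init)

/-- `𝓑_u(w) = [b(u, w, ·) + b(w, u, ·); 0]`. -/
def convectionOp (u w : XSpace Ω ΓD T) : DataSpace Ω ΓD T :=
  (Filter.Germ.ofFun fun t v =>
    triForm (u.val t) (w.val t) v + triForm (w.val t) (u.val t) v, 0)

/-- The linearized operator `𝓖_u(w) = 𝓢(w) + 𝓑_u(w)`. -/
def linearizedOp (u w : XSpace Ω ΓD T) : DataSpace Ω ΓD T :=
  stokesOp w + convectionOp u w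

end MixedNS

end

/-!
Let `w` be the difference of two elements of `X` with the same image under `𝓖_u`. Then `w(0) = 0`
and `(w', v) + ((w, v)) + b(u, w, v) + b(w, u, v) = 0` for all `v ∈ V_κ` and almost every `t`. The
choice `v = w(t)` gives `(w', w) = -‖∇w‖² - b(u, w, w) - b(w, u, w)`, and the point is to absorb the
convective terms.

The tool is Ladyzhenskaya's inequality `‖v‖²_{L⁴} ≤ C ‖v‖_{L²} ‖v‖_{W^{1,2}}` in `V_κ`
(`exists_normFour_sq_le`). It follows from the embedding `W^{1,1}(Ω) ⊆ L²(Ω)`, applied to `‖φ‖²` for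
smooth fields `φ`, by passing to the closure with Fatou's lemma. The embedding
(`exists_lintegral_sq_le`) needs neither extension operators nor a straightening of the boundary:
near each point of `Ω̄` there are two independent directions along which all points of `Ω` can be
moved by a fixed distance inside `Ω`. Hence `|g(y)|` is bounded by a multiple of the integral of
`|g| + |∇g|` over `Ω ∩ ℓ` for the line `ℓ` through `y` in either direction, and in the corresponding
linear coordinates the product of the two bounds is integrated by Tonelli's theorem. No boundary
condition and no Poincaré inequality is used.

With Hölder's and Young's inequalities this yields `(w', w) ≤ (3 + 4 C⁴ ‖u‖⁴_{W^{1,2}}) ‖w‖²`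
(`neg_triForm_le`). The coefficient (with `‖u‖_{W^{1,2}}` read as `‖u‖ + ‖∇u‖`) is integrable in
time, because `‖∇u‖² = (f, u) ≤ ‖f‖ ‖u‖` with `f ∈ L²(0, T; L²_κ)` and `u` is bounded in `L²(Ω)²`
(`XSpace.exists_integrable_pow_four`). A Gronwall lemma for absolutely continuous functions
(`primitive_eq_zero_of_inner_le`) then gives `w = 0`.
-/

noncomputable section

/-! ### Absolutely continuous functions and a Gronwall lemma -/

/-- A function whose increments are dominated by those of an absolutely continuous function is
absolutely continuous. -/
lemma AbsolutelyContinuousOnInterval.of_dist_le {X Y : Type*} [PseudoMetricSpace X]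
    [PseudoMetricSpace Y] {f : ℝ → X} {g : ℝ → Y} {a b K : ℝ}
    (hf : AbsolutelyContinuousOnInterval f a b)
    (hg : ∀ x ∈ uIcc a b, ∀ y ∈ uIcc a b, dist (g x) (g y) ≤ K * dist (f x) (f y)) :
    AbsolutelyContinuousOnInterval g a b := by
  unfold AbsolutelyContinuousOnInterval at hf ⊢
  refine squeeze_zero' (Filter.Eventually.of_forall fun _ => Finset.sum_nonneg fun i _ =>
    dist_nonneg) ?_ (by simpa using hf.const_mul K)
  rw [Filter.eventually_inf_principal]
  filter_upwards with I hI
  rw [Finset.mul_sum]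
  exact Finset.sum_le_sum fun i hi => hg _ (hI.1 i hi).1 _ (hI.1 i hi).2

/-- The primitive of an integrable function with values in a normed space is absolutely
continuous. -/
lemma MeasureTheory.Integrable.absolutelyContinuousOnInterval_primitive {E : Type*}
    [NormedAddCommGroup E] [NormedSpace ℝ E] {k : ℝ → E} (hk : Integrable k) (a b : ℝ) :
    AbsolutelyContinuousOnInterval (fun t => ∫ s in a..t, k s) a b := by
  have hn : AbsolutelyContinuousOnInterval (fun t => ∫ s in a..t, ‖k s‖) a b :=
    hk.norm.intervalIntegrable.absolutelyContinuousOnInterval_intervalIntegral (by simp)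
  refine hn.of_dist_le (K := 1) fun x _ y _ => ?_
  rw [one_mul, dist_comm, dist_comm (∫ s in a..x, ‖k s‖), dist_eq_norm, Real.dist_eq,
    intervalIntegral.integral_interval_sub_left hk.intervalIntegrable hk.intervalIntegrable,
    intervalIntegral.integral_interval_sub_left hk.norm.intervalIntegrable
      hk.norm.intervalIntegrable]
  exact intervalIntegral.norm_integral_le_abs_integral_norm

/-- A Gronwall lemma with an integrable coefficient: if `(W', W) ≤ h ‖W‖²` almost everywhere and
`W(0) = 0`, where `W` is absolutely continuous with values in a Hilbert space, then `W = 0`. The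
function `‖W‖² exp (-2 ∫ h)` is absolutely continuous and has a nonpositive derivative. -/
lemma primitive_eq_zero_of_inner_le {E : Type*} [NormedAddCommGroup E] [InnerProductSpace ℝ E]
    [CompleteSpace E] {k : ℝ → E} {h : ℝ → ℝ} {T : ℝ} (hk : Integrable k) (hh : Integrable h)
    (hle : ∀ᵐ t, t ∈ Ioo 0 T →
      inner ℝ (k t) (∫ s in (0 : ℝ)..t, k s) ≤ h t * ‖∫ s in (0 : ℝ)..t, k s‖ ^ 2)
    {t : ℝ} (ht : t ∈ Icc 0 T) : ∫ s in (0 : ℝ)..t, k s = 0 := by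
  set W : ℝ → E := fun t => ∫ s in (0 : ℝ)..t, k s with hW
  set H : ℝ → ℝ := fun t => ∫ s in (0 : ℝ)..t, h s with hH
  have acW : AbsolutelyContinuousOnInterval W 0 t :=
    hk.absolutelyContinuousOnInterval_primitive 0 t
  have acH : AbsolutelyContinuousOnInterval H 0 t :=
    hh.absolutelyContinuousOnInterval_primitive 0 t
  have acN : AbsolutelyContinuousOnInterval (fun t => ‖W t‖) 0 t :=
    acW.of_dist_le fun x _ y _ => lipschitzWith_one_norm.dist_le_mul (W x) (W y)
  obtain ⟨C, hC⟩ := acH.exists_bound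
  obtain ⟨K, hK⟩ := (Real.contDiff_exp.comp (contDiff_const.mul contDiff_id) :
    ContDiff ℝ 1 (Real.exp ∘ fun x : ℝ => (-2 : ℝ) * id x)).contDiffOn.exists_lipschitzOnWith
    (s := Icc (-C) C) (by decide) (convex_Icc _ _) isCompact_Icc
  have acE : AbsolutelyContinuousOnInterval (fun t => Real.exp (-2 * H t)) 0 t :=
    acH.of_dist_le fun x hx y hy => hK.dist_le_mul _ (abs_le.1 (hC x hx)) _ (abs_le.1 (hC y hy))
  have acZ := (acN.mul acN).mul acE
  have hint := acZ.integral_deriv_eq_sub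
  have hneg : ∫ s in (0 : ℝ)..t, deriv (((fun t => ‖W t‖) * fun t => ‖W t‖) *
      fun t => Real.exp (-2 * H t)) s ≤ 0 := by
    rw [intervalIntegral.integral_of_le ht.1]
    refine setIntegral_nonpos_ae measurableSet_Ioc ?_
    have hT : ∀ᵐ s : ℝ, s ≠ T := by simp [ae_iff, measure_singleton]
    filter_upwards [hle, hT, LocallyIntegrable.ae_hasDerivAt_integral hk.locallyIntegrable,
      LocallyIntegrable.ae_hasDerivAt_integral hh.locallyIntegrable] with s h1 h2 h3 h4 hs
    have hW' : HasDerivAt W (k s) s := h3 0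
    have hH' : HasDerivAt H (h s) s := h4 0
    have hN := hW'.inner ℝ hW'
    have hE := (hH'.const_mul (-2)).exp
    have hfun : (((fun t => ‖W t‖) * fun t => ‖W t‖) * fun t => Real.exp (-2 * H t)) =
        (fun t => inner ℝ (W t) (W t)) * fun t => Real.exp (-2 * H t) := by
      ext r
      simp [pow_two]
    rw [hfun, (hN.mul hE).deriv, real_inner_comm, real_inner_self_eq_norm_sq]
    have h5 : inner ℝ (k s) (W s) ≤ h s * ‖W s‖ ^ 2 :=
      h1 ⟨hs.1, lt_of_le_of_ne (hs.2.trans ht.2) h2⟩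
    nlinarith [mul_nonneg (Real.exp_pos (-2 * H s)).le (sub_nonneg.2 h5)]
  rw [hint] at hneg
  have h0 : W 0 = 0 := by simp [hW]
  simp only [Pi.mul_apply, h0, norm_zero, mul_zero, zero_mul, sub_zero] at hneg
  have h6 := Real.exp_pos (-2 * H t)
  have h7 : ‖W t‖ * ‖W t‖ ≤ 0 := by
    by_contra! hc
    exact absurd hneg (not_le.2 (mul_pos hc h6))
  exact norm_eq_zero.1 (mul_self_eq_zero.1 (le_antisymm h7 (mul_self_nonneg _)))

namespace MixedNS

/-! ### Lipschitz domains: the cone property and line integrals -/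

/-- Linear coordinates on the plane whose axes are the directions `e⁻¹(0, 1)` and `e⁻¹(1, L)`. -/
def coneCoord (e : Plane ≃ₗᵢ[ℝ] Plane) (L : ℝ) : (ℝ × ℝ) ≃L[ℝ] Plane :=
  LinearEquiv.toContinuousLinearEquiv
    { toFun := fun z => e.symm !₂[z.2, z.1 + L * z.2]
      map_add' := fun z w => by
        rw [← map_add]
        congr 1
        ext i
        fin_cases i
        · simp
        · simp only [Fin.mk_one, Prod.snd_add, Prod.fst_add, PiLp.add_apply]
          simp
          ring
      map_smul' := fun c z => by
        rw [RingHom.id_apply, ← map_smul]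
        congr 1
        ext i
        fin_cases i
        · simp
        · simp
          ring
      invFun := fun y => (e y 1 - L * e y 0, e y 0)
      left_inv := fun z => by simp
      right_inv := fun y => by
        refine e.injective ((e.apply_symm_apply _).trans ?_)
        ext i
        fin_cases i <;> simp }

lemma coneCoord_apply (e : Plane ≃ₗᵢ[ℝ] Plane) (L : ℝ) (z : ℝ × ℝ) :
    e (coneCoord e L z) = !₂[z.2, z.1 + L * z.2] :=
  e.apply_symm_apply _

/-- A domain with Lipschitz boundary has the cone property in the following form: near each point of
its closure there are two independent directions, the axes of the coordinates `Φ`, along which all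
points of the domain can be moved by a fixed distance without leaving the domain. -/
lemma LipschitzBoundary.exists_directions {Ω : Set Plane} (ho : IsOpen Ω)
    (hL : LipschitzBoundary Ω) {x : Plane} (hx : x ∈ closure Ω) :
    ∃ (Φ : (ℝ × ℝ) ≃L[ℝ] Plane) (δ ρ : ℝ), 0 < δ ∧ 0 < ρ ∧
      ∀ y ∈ Ω ∩ Metric.ball x δ, ∀ s ∈ Icc 0 ρ,
        y + s • Φ (1, 0) ∈ Ω ∧ y + s • Φ (0, 1) ∈ Ω := by
  -- A fixed distance keeps points of the ball of radius `r / 2` in the ball of radius `r`.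
  have key : ∀ (Φ : (ℝ × ℝ) ≃L[ℝ] Plane) (r : ℝ), 0 < r → ∃ ρ : ℝ, 0 < ρ ∧
      ∀ y ∈ Metric.ball x (r / 2), ∀ s ∈ Icc 0 ρ,
        y + s • Φ (1, 0) ∈ Metric.ball x r ∧ y + s • Φ (0, 1) ∈ Metric.ball x r := by
    intro Φ r hr
    have hm : 0 < ‖Φ (1, 0)‖ + ‖Φ (0, 1)‖ + 1 := by positivity
    refine ⟨r / 2 / (‖Φ (1, 0)‖ + ‖Φ (0, 1)‖ + 1), by positivity, fun y hy s hs => ?_⟩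
    have h1 : s * (‖Φ (1, 0)‖ + ‖Φ (0, 1)‖ + 1) ≤ r / 2 := (le_div_iff₀ hm).1 hs.2
    have h2 : ∀ d : Plane, ‖d‖ ≤ ‖Φ (1, 0)‖ + ‖Φ (0, 1)‖ + 1 → y + s • d ∈ Metric.ball x r := by
      intro d hd
      rw [mem_ball_iff_norm] at hy ⊢
      calc ‖y + s • d - x‖ = ‖(y - x) + s • d‖ := by congr 1; abel
        _ ≤ ‖y - x‖ + ‖s • d‖ := norm_add_le _ _
        _ < r := by
            rw [norm_smul, Real.norm_of_nonneg hs.1]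
            nlinarith [mul_le_mul_of_nonneg_left hd hs.1]
    exact ⟨h2 _ (by linarith [norm_nonneg (Φ (0, 1))]), h2 _ (by linarith [norm_nonneg (Φ (1, 0))])⟩
  by_cases hxo : x ∈ Ω
  · obtain ⟨r, hr, hb⟩ := Metric.isOpen_iff.1 ho x hxo
    obtain ⟨ρ, hρ, h⟩ := key (coneCoord (LinearIsometryEquiv.refl ℝ Plane) 0) r hr
    exact ⟨_, r / 2, ρ, by positivity, hρ, fun y hy s hs =>
      ⟨hb (h y hy.2 s hs).1, hb (h y hy.2 s hs).2⟩⟩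
  -- The epigraph of a function with Lipschitz constant `L` is stable under the directions `(0, 1)`
  -- and `(1, L)`.
  · obtain ⟨e, a, L, r, ha, hr, hb⟩ := hL x ⟨hx, fun h => hxo (interior_subset h)⟩
    obtain ⟨ρ, hρ, h⟩ := key (coneCoord e L) r hr
    refine ⟨coneCoord e L, r / 2, ρ, by positivity, hρ, fun y hy s hs => ?_⟩
    have hy' := (hb y (Metric.ball_subset_ball (by linarith) hy.2)).1 hy.1
    have e1 : ∀ z, e (y + s • coneCoord e L z) = e y + s • !₂[z.2, z.1 + L * z.2] := fun z => by
      rw [map_add, map_smul, coneCoord_apply]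
    constructor
    · rw [hb _ (h y hy.2 s hs).1, e1]
      simp
      linarith [hs.1]
    · rw [hb _ (h y hy.2 s hs).2, e1]
      simp
      have h3 := ha.dist_le_mul (e y 0 + s) (e y 0)
      rw [Real.dist_eq, Real.dist_eq, add_sub_cancel_left, abs_of_nonneg hs.1] at h3
      linarith [le_abs_self (a (e y 0 + s) - a (e y 0))]

/-- The two-dimensional case of the Loomis–Whitney argument: integrals over all parallels to one
axis depend on the other coordinate alone, so the integral of their product factors. -/
lemma exists_lintegral_mul_line_integrals_le (Φ : (ℝ × ℝ) ≃L[ℝ] Plane) :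
    ∃ C : NNReal, ∀ G : Plane → ENNReal, Measurable G →
      ∫⁻ y, (∫⁻ s : ℝ, G (y + s • Φ (1, 0))) * (∫⁻ s : ℝ, G (y + s • Φ (0, 1))) ≤
        C * (∫⁻ y, G y) ^ 2 := by
  have hH : (Measure.map Φ volume).IsAddHaarMeasure := Φ.isAddHaarMeasure_map volume
  set c := Measure.addHaarScalarFactor (volume : Measure Plane) (Measure.map Φ volume) with hc
  have hcpos : 0 < c := Measure.addHaarScalarFactor_pos_of_isAddHaarMeasure _ _
  have hvol : (volume : Measure Plane) = c • Measure.map Φ volume :=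
    Measure.isAddLeftInvariant_eq_smul _ _
  have hint : ∀ F : Plane → ENNReal, ∫⁻ y, F y = c * ∫⁻ z : ℝ × ℝ, F (Φ z) := by
    intro F
    have hF : ∫⁻ y, F y ∂Measure.map Φ volume = ∫⁻ z : ℝ × ℝ, F (Φ z) :=
      Φ.toHomeomorph.measurableEmbedding.lintegral_map F
    rw [← hF, ← smul_eq_mul, ← ENNReal.smul_def, ← lintegral_smul_measure, ← hvol]
  -- The left-hand side carries one factor `c`, the square on the right two.
  refine ⟨c⁻¹, fun G hG => ?_⟩
  have hGΦ : Measurable fun z => G (Φ z) := hG.comp Φ.continuous.measurable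
  have h1 : ∀ z : ℝ × ℝ, ∫⁻ s : ℝ, G (Φ z + s • Φ (1, 0)) = ∫⁻ s : ℝ, G (Φ (s, z.2)) := by
    intro z
    rw [← lintegral_add_left_eq_self (fun s : ℝ => G (Φ (s, z.2))) z.1]
    refine lintegral_congr fun s => ?_
    rw [← map_smul, ← map_add]
    congr 2
    ext <;> simp
  have h2 : ∀ z : ℝ × ℝ, ∫⁻ s : ℝ, G (Φ z + s • Φ (0, 1)) = ∫⁻ s : ℝ, G (Φ (z.1, s)) := by
    intro z
    rw [← lintegral_add_left_eq_self (fun s : ℝ => G (Φ (z.1, s))) z.2]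
    refine lintegral_congr fun s => ?_
    rw [← map_smul, ← map_add]
    congr 2
    ext <;> simp
  have m1 : Measurable fun q : ℝ => ∫⁻ s : ℝ, G (Φ (s, q)) := hGΦ.lintegral_prod_left'
  have m2 : Measurable fun p : ℝ => ∫⁻ s : ℝ, G (Φ (p, s)) := hGΦ.lintegral_prod_right'
  have e1 : ∫⁻ q : ℝ, ∫⁻ s : ℝ, G (Φ (s, q)) = ∫⁻ z : ℝ × ℝ, G (Φ z) :=
    (lintegral_prod_symm' _ hGΦ).symm
  have e2 : ∫⁻ p : ℝ, ∫⁻ s : ℝ, G (Φ (p, s)) = ∫⁻ z : ℝ × ℝ, G (Φ z) :=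
    (lintegral_prod _ hGΦ.aemeasurable).symm
  rw [hint, hint]
  simp_rw [h1, h2, mul_comm (∫⁻ s : ℝ, G (Φ (s, _)))]
  rw [Measure.volume_eq_prod, lintegral_prod_mul m2.aemeasurable m1.aemeasurable, e1, e2,
    ENNReal.coe_inv hcpos.ne']
  have hc0 : (c : ENNReal) ≠ 0 := by exact_mod_cast hcpos.ne'
  refine le_of_eq ?_
  rw [← Measure.volume_eq_prod, pow_two, mul_assoc (c : ENNReal),
    ← mul_assoc _ (c : ENNReal) (_ * _), ENNReal.inv_mul_cancel hc0 ENNReal.coe_ne_top, one_mul]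
  ring

/-! ### The embedding of `W^{1,1}` into `L²` -/

/-- A value of a `C¹` function is controlled by the integrals of the function and of its derivative
over an interval. -/
lemma norm_le_integral_add_integral_deriv {γ γ' : ℝ → ℝ} {ρ : ℝ} (hρ : 0 < ρ)
    (hγ : ∀ s, HasDerivAt γ (γ' s) s) (hγ' : Continuous γ') :
    ‖γ 0‖ ≤ ∫ s in (0 : ℝ)..ρ, (ρ⁻¹ * ‖γ s‖ + ‖γ' s‖) := by
  have hc : Continuous γ := continuous_iff_continuousAt.2 fun s => (hγ s).continuousAt
  -- This bound is averaged over `s ∈ [0, ρ]` below.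
  have h1 : ∀ s ∈ Icc 0 ρ, ‖γ 0‖ ≤ ‖γ s‖ + ∫ r in (0 : ℝ)..ρ, ‖γ' r‖ := by
    intro s hs
    have h2 : ∫ r in (0 : ℝ)..s, γ' r = γ s - γ 0 :=
      intervalIntegral.integral_eq_sub_of_hasDerivAt (fun r _ => hγ r)
        (hγ'.intervalIntegrable _ _)
    have h3 : ‖∫ r in (0 : ℝ)..s, γ' r‖ ≤ ∫ r in (0 : ℝ)..s, ‖γ' r‖ :=
      intervalIntegral.norm_integral_le_integral_norm hs.1
    have h4 : ∫ r in (0 : ℝ)..s, ‖γ' r‖ ≤ ∫ r in (0 : ℝ)..ρ, ‖γ' r‖ :=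
      intervalIntegral.integral_mono_interval le_rfl hs.1 hs.2
        (Filter.Eventually.of_forall fun r => norm_nonneg _) (hγ'.norm.intervalIntegrable _ _)
    rw [h2] at h3
    have h5 : ‖γ 0‖ ≤ ‖γ s‖ + ‖γ s - γ 0‖ := by
      have := norm_sub_le (γ s) (γ s - γ 0)
      rwa [sub_sub_cancel] at this
    linarith
  have h6 := intervalIntegral.integral_mono_on hρ.le
    (f := fun _ => ‖γ 0‖) (μ := volume) (g := fun s => ‖γ s‖ + ∫ r in (0 : ℝ)..ρ, ‖γ' r‖)
    intervalIntegrable_const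
    ((hc.norm.add continuous_const).intervalIntegrable _ _) h1
  rw [intervalIntegral.integral_const,
    intervalIntegral.integral_add (hc.norm.intervalIntegrable _ _)
      (continuous_const.intervalIntegrable _ _), intervalIntegral.integral_const, smul_eq_mul,
    smul_eq_mul, sub_zero] at h6
  have hc' : Continuous fun s => ρ⁻¹ * ‖γ s‖ := continuous_const.mul hc.norm
  rw [intervalIntegral.integral_add (hc'.intervalIntegrable _ _)
    (hγ'.norm.intervalIntegrable _ _), intervalIntegral.integral_const_mul]
  have h7 : ρ⁻¹ * (ρ * ‖γ 0‖) ≤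
      ρ⁻¹ * ((∫ s in (0 : ℝ)..ρ, ‖γ s‖) + ρ * ∫ r in (0 : ℝ)..ρ, ‖γ' r‖) :=
    mul_le_mul_of_nonneg_left h6 (inv_nonneg.2 hρ.le)
  rw [mul_add, inv_mul_cancel_left₀ hρ.ne', inv_mul_cancel_left₀ hρ.ne'] at h7
  exact h7

/-- A value of a `C¹` function at a point is controlled by a line integral over the part of the line
in `Ω`, if an initial piece of the line lies in `Ω`. -/
lemma enorm_le_line_integral {Ω : Set Plane} {g : Plane → ℝ} (hg : ContDiff ℝ 1 g) {y d : Plane}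
    {ρ K : ℝ} (hρ : 0 < ρ) (hd : ∀ s ∈ Icc 0 ρ, y + s • d ∈ Ω) (hK : ρ⁻¹ ≤ K) (hK' : ‖d‖ ≤ K) :
    ‖g y‖ₑ ≤ ∫⁻ s : ℝ, Ω.indicator
      (fun x => ENNReal.ofReal K * (‖g x‖ₑ + ‖fderiv ℝ g x‖ₑ)) (y + s • d) := by
  have hline : ∀ s : ℝ, HasDerivAt (fun s : ℝ => y + s • d) d s := fun s => by
    simpa using ((hasDerivAt_id s).smul_const d).const_add y
  have hline' : Continuous fun s : ℝ => y + s • d := by fun_prop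
  have hγ : ∀ s, HasDerivAt (fun s : ℝ => g (y + s • d)) (fderiv ℝ g (y + s • d) d) s := fun s =>
    ((hg.differentiable (by simp)) _).hasFDerivAt.comp_hasDerivAt s (hline s)
  have hγ' : Continuous fun s : ℝ => fderiv ℝ g (y + s • d) d :=
    ((hg.continuous_fderiv (by simp)).comp hline').clm_apply continuous_const
  have hc : Continuous fun s : ℝ => g (y + s • d) := hg.continuous.comp hline'
  have h1 := norm_le_integral_add_integral_deriv hρ hγ hγ'
  simp only [zero_smul, add_zero] at h1
  rw [intervalIntegral.integral_of_le hρ.le] at h1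
  have hi : IntegrableOn (fun s : ℝ => ρ⁻¹ * ‖g (y + s • d)‖ + ‖fderiv ℝ g (y + s • d) d‖)
      (Ioc 0 ρ) :=
    ((((continuous_const.mul hc.norm).add hγ'.norm).intervalIntegrable 0 ρ).1)
  have hn : ∀ s : ℝ, 0 ≤ ρ⁻¹ * ‖g (y + s • d)‖ + ‖fderiv ℝ g (y + s • d) d‖ := fun s => by
    positivity
  have h2 := ENNReal.ofReal_le_ofReal h1
  rw [ofReal_integral_eq_lintegral_ofReal hi (Filter.Eventually.of_forall hn),
    ofReal_norm] at h2
  refine h2.trans ?_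
  rw [← lintegral_indicator measurableSet_Ioc]
  refine lintegral_mono fun s => ?_
  by_cases hs : s ∈ Ioc 0 ρ
  swap
  · rw [indicator_of_notMem hs]
    exact zero_le
  rw [indicator_of_mem hs]
  rw [indicator_of_mem (hd s (Ioc_subset_Icc_self hs)), ← ofReal_norm,
    ← ofReal_norm, ← ENNReal.ofReal_add (norm_nonneg _) (norm_nonneg _),
    ← ENNReal.ofReal_mul ((inv_nonneg.2 hρ.le).trans hK)]
  refine ENNReal.ofReal_le_ofReal ?_
  have h3 := (fderiv ℝ g (y + s • d)).le_opNorm d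
  have h4 := mul_le_mul_of_nonneg_left hK' (norm_nonneg (fderiv ℝ g (y + s • d)))
  have h5 := mul_le_mul_of_nonneg_right hK (norm_nonneg (g (y + s • d)))
  linarith

/-- The embedding `W^{1,1}(Ω) ⊆ L²(Ω)` near a point of the closure: one factor of `|g|²` is bounded
by a line integral in the first direction of the cone property, the other one in the second. -/
lemma exists_nhds_lintegral_sq_le {Ω : Set Plane} (ho : IsOpen Ω) (hL : LipschitzBoundary Ω)
    {x : Plane} (hx : x ∈ closure Ω) :
    ∃ U ∈ nhds x, ∃ C : NNReal, ∀ g : Plane → ℝ, ContDiff ℝ 1 g →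
      ∫⁻ y in Ω ∩ U, ‖g y‖ₑ ^ 2 ≤ C * (∫⁻ y in Ω, (‖g y‖ₑ + ‖fderiv ℝ g y‖ₑ)) ^ 2 := by
  obtain ⟨Φ, δ, ρ, hδ, hρ, h⟩ := hL.exists_directions ho hx
  obtain ⟨C, hC⟩ := exists_lintegral_mul_line_integrals_le Φ
  set K : ℝ := max ρ⁻¹ (max ‖Φ (1, 0)‖ ‖Φ (0, 1)‖) with hK
  refine ⟨Metric.ball x δ, Metric.ball_mem_nhds x hδ, C * K.toNNReal ^ 2, fun g hg => ?_⟩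
  set G : Plane → ENNReal :=
    Ω.indicator (fun x => ENNReal.ofReal K * (‖g x‖ₑ + ‖fderiv ℝ g x‖ₑ)) with hG
  have hm : Measurable fun x => ‖g x‖ₑ + ‖fderiv ℝ g x‖ₑ :=
    (hg.continuous.enorm.add (hg.continuous_fderiv (by simp)).enorm).measurable
  have hGm : Measurable G := (hm.const_mul _).indicator ho.measurableSet
  have hGi : ∫⁻ y, G y =
      ENNReal.ofReal K * ∫⁻ y in Ω, (‖g y‖ₑ + ‖fderiv ℝ g y‖ₑ) := by
    rw [hG, lintegral_indicator ho.measurableSet, lintegral_const_mul _ hm]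
  calc ∫⁻ y in Ω ∩ Metric.ball x δ, ‖g y‖ₑ ^ 2
      ≤ ∫⁻ y in Ω ∩ Metric.ball x δ,
          (∫⁻ s : ℝ, G (y + s • Φ (1, 0))) * (∫⁻ s : ℝ, G (y + s • Φ (0, 1))) := by
        refine setLIntegral_mono' (ho.measurableSet.inter Metric.isOpen_ball.measurableSet)
          fun y hy => ?_
        rw [pow_two]
        exact mul_le_mul'
          (enorm_le_line_integral hg hρ (fun s hs => (h y hy s hs).1) (le_max_left _ _)
            ((le_max_left _ _).trans (le_max_right _ _)))
          (enorm_le_line_integral hg hρ (fun s hs => (h y hy s hs).2) (le_max_left _ _)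
            ((le_max_right _ _).trans (le_max_right _ _)))
    _ ≤ C * (∫⁻ y, G y) ^ 2 := (setLIntegral_le_lintegral _ _).trans (hC G hGm)
    _ = _ := by
        rw [hGi, mul_pow, ← mul_assoc]
        simp [ENNReal.ofReal]

/-- The embedding `W^{1,1}(Ω) ⊆ L²(Ω)` for a bounded plane domain with Lipschitz boundary, stated
for functions which are `C¹` up to the boundary. -/
lemma exists_lintegral_sq_le {Ω : Set Plane} (ho : IsOpen Ω) (hb : Bornology.IsBounded Ω)
    (hL : LipschitzBoundary Ω) :
    ∃ C : NNReal, ∀ g : Plane → ℝ, ContDiff ℝ 1 g →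
      ∫⁻ y in Ω, ‖g y‖ₑ ^ 2 ≤ C * (∫⁻ y in Ω, (‖g y‖ₑ + ‖fderiv ℝ g y‖ₑ)) ^ 2 := by
  refine hb.isCompact_closure.induction_on
    (p := fun S => ∃ C : NNReal, ∀ g : Plane → ℝ, ContDiff ℝ 1 g →
      ∫⁻ y in Ω ∩ S, ‖g y‖ₑ ^ 2 ≤ C * (∫⁻ y in Ω, (‖g y‖ₑ + ‖fderiv ℝ g y‖ₑ)) ^ 2)
    ?_ ?_ ?_ ?_ |>.imp fun C hC g hg => ?_
  · exact ⟨0, fun g _ => by simp⟩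
  · rintro S S' hS ⟨C, hC⟩
    exact ⟨C, fun g hg => (lintegral_mono_set (inter_subset_inter_right _ hS)).trans (hC g hg)⟩
  · rintro S S' ⟨C, hC⟩ ⟨C', hC'⟩
    refine ⟨C + C', fun g hg => ?_⟩
    rw [inter_union_distrib_left, ENNReal.coe_add, add_mul]
    exact (lintegral_union_le _ _ _).trans (add_le_add (hC g hg) (hC' g hg))
  · intro x hx
    obtain ⟨U, hU, h⟩ := exists_nhds_lintegral_sq_le ho hL hx
    exact ⟨U, mem_nhdsWithin_of_mem_nhds hU, h⟩
  · have := hC g hg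
    rwa [inter_eq_left.2 subset_closure] at this

/-! ### Ladyzhenskaya's inequality -/

lemma norm_fderiv_le_norm_jacobian (φ : Plane → Plane) (x : Plane) :
    ‖fderiv ℝ φ x‖ ≤ ‖jacobian φ x‖ := by
  refine ContinuousLinearMap.opNorm_le_bound _ (norm_nonneg _) fun v => ?_
  have hv : ∀ i, fderiv ℝ φ x v i = ∑ j, jacobian φ x (i, j) * v j := by
    intro i
    have : v = ∑ j, v j • EuclideanSpace.single j (1 : ℝ) := by
      ext k
      fin_cases k <;> simp
    conv_lhs => rw [this]
    simp [jacobian, Fin.sum_univ_two]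
    ring
  refine abs_le_of_sq_le_sq' ?_ (by positivity) |>.2
  rw [mul_pow, EuclideanSpace.norm_sq_eq, EuclideanSpace.norm_sq_eq, EuclideanSpace.norm_sq_eq]
  simp only [Fin.sum_univ_two, hv, Real.norm_eq_abs, sq_abs, Fintype.sum_prod_type]
  nlinarith [sq_nonneg (jacobian φ x (0, 0) * v 1 - jacobian φ x (0, 1) * v 0),
    sq_nonneg (jacobian φ x (1, 0) * v 1 - jacobian φ x (1, 1) * v 0)]

lemma continuous_jacobian {φ : Plane → Plane} (hφ : ContDiff ℝ 1 φ) : Continuous (jacobian φ) := by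
  refine (PiLp.continuous_toLp 2 _).comp (continuous_pi fun p => ?_)
  exact (PiLp.continuous_apply 2 _ p.1).comp
    ((hφ.continuous_fderiv (by simp)).clm_apply continuous_const)

/-- Ladyzhenskaya's inequality for vector fields which are `C¹` up to the boundary. It is the
embedding `W^{1,1}(Ω) ⊆ L²(Ω)` applied to `‖φ‖²`. -/
lemma exists_eLpNorm_four_le {Ω : Set Plane} (ho : IsOpen Ω) (hb : Bornology.IsBounded Ω)
    (hL : LipschitzBoundary Ω) :
    ∃ C : NNReal, ∀ φ : Plane → Plane, ContDiff ℝ 1 φ →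
      eLpNorm φ 4 (volume.restrict Ω) ^ 2 ≤ C * (eLpNorm φ 2 (volume.restrict Ω) *
        (eLpNorm φ 2 (volume.restrict Ω) + eLpNorm (jacobian φ) 2 (volume.restrict Ω))) := by
  obtain ⟨C, hC⟩ := exists_lintegral_sq_le ho hb hL
  refine ⟨NNReal.sqrt C * 2, fun φ hφ => ?_⟩
  set μ := (volume : Measure Plane).restrict Ω
  have hcJ := continuous_jacobian hφ
  have hg : ContDiff ℝ 1 fun x => ‖φ x‖ ^ 2 := hφ.norm_sq ℝ
  have h1 := hC _ hg
  have hfd : ∀ x, ‖fderiv ℝ (fun x => ‖φ x‖ ^ 2) x‖ ≤ 2 * (‖φ x‖ * ‖jacobian φ x‖) := by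
    intro x
    have hd := ((hφ.differentiable (by simp)) x).hasFDerivAt.norm_sq
    rw [hd.fderiv]
    refine ContinuousLinearMap.opNorm_le_bound _ (by positivity) fun v => ?_
    simp only [smul_apply, ContinuousLinearMap.comp_apply, innerSL_apply_apply,
      nsmul_eq_mul, norm_mul]
    have h2 := (norm_inner_le_norm (𝕜 := ℝ) (φ x) (fderiv ℝ φ x v)).trans
      (mul_le_mul_of_nonneg_left (((fderiv ℝ φ x).le_opNorm v).trans
        (mul_le_mul_of_nonneg_right (norm_fderiv_le_norm_jacobian φ x) (norm_nonneg v)))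
        (norm_nonneg (φ x)))
    simp
    simp at h2
    linarith
  have hpt : ∀ x, ‖‖φ x‖ ^ 2‖ₑ + ‖fderiv ℝ (fun x => ‖φ x‖ ^ 2) x‖ₑ ≤
      2 * (‖φ x‖ₑ * (‖φ x‖ₑ + ‖jacobian φ x‖ₑ)) := by
    intro x
    have h2 : ‖fderiv ℝ (fun x => ‖φ x‖ ^ 2) x‖ₑ ≤ 2 * (‖φ x‖ₑ * ‖jacobian φ x‖ₑ) := by
      have := ENNReal.ofReal_le_ofReal (hfd x)
      rw [ENNReal.ofReal_mul (by norm_num), ENNReal.ofReal_mul (norm_nonneg _)] at this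
      simpa using this
    have h3 : ‖‖φ x‖ ^ 2‖ₑ = ‖φ x‖ₑ * ‖φ x‖ₑ := by
      rw [enorm_pow, enorm_norm, pow_two]
    rw [h3, mul_add, mul_add]
    refine add_le_add ?_ h2
    rw [two_mul]
    exact le_self_add
  have hsum : ∫⁻ x, ‖φ x‖ₑ * (‖φ x‖ₑ + ‖jacobian φ x‖ₑ) ∂μ ≤
      eLpNorm φ 2 μ * (eLpNorm φ 2 μ + eLpNorm (jacobian φ) 2 μ) := by
    have h2 := eLpNorm_smul_le_mul_eLpNorm (p := 2) (q := 2) (r := 1) (μ := μ)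
      (f := fun x => ‖φ x‖ + ‖jacobian φ x‖) (φ := fun x => ‖φ x‖)
      (hφ.continuous.norm.add hcJ.norm).aestronglyMeasurable
      hφ.continuous.norm.aestronglyMeasurable
    have h3 : eLpNorm (fun x => ‖φ x‖ + ‖jacobian φ x‖) 2 μ ≤
        eLpNorm φ 2 μ + eLpNorm (jacobian φ) 2 μ := by
      have := eLpNorm_add_le (p := 2) (μ := μ) (f := fun x => ‖φ x‖)
        (g := fun x => ‖jacobian φ x‖) hφ.continuous.norm.aestronglyMeasurable
        hcJ.norm.aestronglyMeasurable (by norm_num)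
      simpa only [eLpNorm_norm] using! this
    rw [eLpNorm_one_eq_lintegral_enorm, eLpNorm_norm] at h2
    refine (le_of_eq (lintegral_congr fun x => ?_)).trans
      (h2.trans (mul_le_mul_right h3 _))
    rw [Pi.smul_apply', smul_eq_mul, enorm_mul, enorm_norm]
    congr 1
    rw [← ofReal_norm, ← ofReal_norm, ← ofReal_norm,
      ← ENNReal.ofReal_add (norm_nonneg _) (norm_nonneg _), Real.norm_of_nonneg (by positivity)]
  have h4 : eLpNorm φ 4 μ ^ 4 = ∫⁻ x, ‖‖φ x‖ ^ 2‖ₑ ^ 2 ∂μ := by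
    have := eLpNorm_nnreal_pow_eq_lintegral (μ := μ) (f := φ) (p := 4) (by norm_num)
    norm_num at this
    rw [this]
    refine lintegral_congr fun x => ?_
    rw [enorm_pow, enorm_norm, ← pow_mul]
  have h5 : (eLpNorm φ 4 μ ^ 2) ^ 2 ≤ ((NNReal.sqrt C * 2 : NNReal) *
      (eLpNorm φ 2 μ * (eLpNorm φ 2 μ + eLpNorm (jacobian φ) 2 μ))) ^ 2 := by
    rw [← pow_mul, h4]
    refine h1.trans ?_
    rw [ENNReal.coe_mul, mul_assoc, mul_pow, ← ENNReal.coe_pow, NNReal.sq_sqrt]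
    gcongr
    refine (lintegral_mono hpt).trans ?_
    rw [lintegral_const_mul]
    · simpa using mul_le_mul_right hsum 2
    · exact (hφ.continuous.enorm.measurable.mul
        (hφ.continuous.enorm.add hcJ.enorm).measurable)
  exact (ENNReal.pow_le_pow_left_iff two_ne_zero).1 h5

variable {Ω ΓD : Set Plane}

/-- The `L⁴` norm of an element of `V_κ`; it is finite on bounded Lipschitz domains, see
`exists_normFour_sq_le`. -/
def VKappa.normFour (v : VKappa Ω ΓD) : ℝ :=
  (eLpNorm v.toLKappa.fn 4 (volume.restrict Ω)).toReal

lemma VKappa.normFour_nonneg (v : VKappa Ω ΓD) : 0 ≤ v.normFour := ENNReal.toReal_nonneg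

/-- Ladyzhenskaya's inequality in `V_κ`. -/
lemma exists_normFour_sq_le (ho : IsOpen Ω) (hb : Bornology.IsBounded Ω)
    (hL : LipschitzBoundary Ω) :
    ∃ C : ℝ, 0 ≤ C ∧ ∀ v : VKappa Ω ΓD,
      MemLp v.toLKappa.fn 4 (volume.restrict Ω) ∧
        v.normFour ^ 2 ≤ C * (‖v.toLKappa‖ * (‖v.toLKappa‖ + ‖v.grad‖)) := by
  obtain ⟨C, hC⟩ := exists_eLpNorm_four_le ho hb hL
  set B : WithLp 2 (L2 Ω × L2Mat Ω) → ℝ := fun p => C * (‖p.fst‖ * (‖p.fst‖ + ‖p.snd‖)) with hB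
  have hBnn : ∀ p, 0 ≤ B p := fun p => by positivity
  have hBc : Continuous B := by
    have h1 : Continuous fun p : WithLp 2 (L2 Ω × L2Mat Ω) => p.fst := WithLp.continuous_fst 2 _ _
    have h2 : Continuous fun p : WithLp 2 (L2 Ω × L2Mat Ω) => p.snd := WithLp.continuous_snd 2 _ _
    exact continuous_const.mul (h1.norm.mul (h1.norm.add h2.norm))
  have htest : ∀ p ∈ testW12 Ω ΓD,
      eLpNorm p.fst 4 (volume.restrict Ω) ≤ ENNReal.ofReal (Real.sqrt (B p)) := by
    rintro p ⟨φ, hφ, h1, h2⟩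
    have h3 := hC φ (hφ.smooth.of_le (by simp))
    rw [← eLpNorm_congr_ae h1, ← eLpNorm_congr_ae h1, ← eLpNorm_congr_ae h2,
      ← Lp.enorm_def, ← Lp.enorm_def, ← ofReal_norm, ← ofReal_norm,
      ← ENNReal.ofReal_add (norm_nonneg _) (norm_nonneg _),
      ← ENNReal.ofReal_mul (norm_nonneg _), ← ENNReal.ofReal_coe_nnreal,
      ← ENNReal.ofReal_mul C.coe_nonneg] at h3
    refine (ENNReal.pow_le_pow_left_iff two_ne_zero).1 (h3.trans (le_of_eq ?_))
    rw [← ENNReal.ofReal_pow (Real.sqrt_nonneg _), Real.sq_sqrt (hBnn p)]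
  refine ⟨C, C.coe_nonneg, fun v => ?_⟩
  have key : eLpNorm v.toLKappa.fn 4 (volume.restrict Ω) ≤
      ENNReal.ofReal (Real.sqrt (B v.1)) := by
    obtain ⟨p, hp, hlim⟩ := mem_closure_iff_seq_limit.1 v.2
    have hfst : Filter.Tendsto (fun n => (p n).fst) Filter.atTop (nhds v.1.fst) :=
      ((WithLp.continuous_fst 2 _ _).tendsto _).comp hlim
    obtain ⟨ns, hns, hae⟩ := (tendstoInMeasure_of_tendsto_Lp hfst).exists_seq_tendsto_ae
    refine (Lp.eLpNorm_lim_le_liminf_eLpNorm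
      (fun n => Lp.aestronglyMeasurable (p (ns n)).fst) _ hae).trans ?_
    have hBl : Filter.Tendsto (fun n => ENNReal.ofReal (Real.sqrt (B (p (ns n))))) Filter.atTop
        (nhds (ENNReal.ofReal (Real.sqrt (B v.1)))) :=
      (((ENNReal.continuous_ofReal.comp (Real.continuous_sqrt.comp hBc)).tendsto _).comp
        (hlim.comp hns.tendsto_atTop))
    rw [← hBl.liminf_eq]
    exact Filter.liminf_le_liminf (Filter.Eventually.of_forall fun n => htest _ (hp _))
  refine ⟨⟨Lp.aestronglyMeasurable _, key.trans_lt ENNReal.ofReal_lt_top⟩, ?_⟩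
  have h1 : v.normFour ≤ Real.sqrt (B v.1) :=
    ENNReal.toReal_le_of_le_ofReal (Real.sqrt_nonneg _) key
  have h2 := pow_le_pow_left₀ v.normFour_nonneg h1 2
  rwa [Real.sq_sqrt (hBnn _)] at h2

/-! ### Estimates for the trilinear form -/

/-- `|a · M b| ≤ ‖b‖ ‖a‖ ‖M‖`, the Cauchy–Schwarz inequality for `M` and `a bᵀ`. -/
lemma abs_sum_mul_le (b a : Plane) (M : Mat2) :
    |∑ i : Fin 2, ∑ j : Fin 2, b j * M (i, j) * a i| ≤ ‖b‖ * ‖a‖ * ‖M‖ := by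
  refine abs_le_of_sq_le_sq ?_ (by positivity)
  rw [mul_pow, mul_pow, EuclideanSpace.norm_sq_eq, EuclideanSpace.norm_sq_eq,
    EuclideanSpace.norm_sq_eq]
  simp only [← Finset.univ_product_univ, Finset.sum_product, Real.norm_eq_abs, sq_abs]
  calc (∑ i : Fin 2, ∑ j : Fin 2, b j * M (i, j) * a i) ^ 2
      = (∑ p : Fin 2 × Fin 2, (b p.2 * a p.1) * M p) ^ 2 := by
        rw [Fintype.sum_prod_type]
        congr 1
        exact Finset.sum_congr rfl fun i _ => Finset.sum_congr rfl fun j _ => by ring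
    _ ≤ (∑ p : Fin 2 × Fin 2, (b p.2 * a p.1) ^ 2) * ∑ p, M p ^ 2 :=
        Finset.sum_mul_sq_le_sq_mul_sq _ _ _
    _ = _ := by
        simp only [Fintype.sum_prod_type, Fin.sum_univ_two]
        ring

/-- The integrand of the trilinear form `b`. -/
def triIntegrand (θ ψ φ : VKappa Ω ΓD) (x : Plane) : ℝ :=
  ∑ i : Fin 2, ∑ j : Fin 2, θ.toLKappa.fn x j * ψ.grad x (i, j) * φ.toLKappa.fn x i

lemma aestronglyMeasurable_triIntegrand (θ ψ φ : VKappa Ω ΓD) :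
    AEStronglyMeasurable (triIntegrand θ ψ φ) (volume.restrict Ω) := by
  have h1 : ∀ (f : L2 Ω) (i : Fin 2),
      AEStronglyMeasurable (fun x => f x i) (volume.restrict Ω) := fun f i =>
    (EuclideanSpace.proj (𝕜 := ℝ) i).continuous.comp_aestronglyMeasurable
      (Lp.aestronglyMeasurable f)
  have h2 : ∀ (f : L2Mat Ω) (p : Fin 2 × Fin 2),
      AEStronglyMeasurable (fun x => f x p) (volume.restrict Ω) := fun f p =>
    (EuclideanSpace.proj (𝕜 := ℝ) p).continuous.comp_aestronglyMeasurable
      (Lp.aestronglyMeasurable f)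
  exact Finset.aestronglyMeasurable_fun_sum _ fun i _ =>
    Finset.aestronglyMeasurable_fun_sum _ fun j _ => ((h1 _ j).mul (h2 _ _)).mul (h1 _ i)

/-- Hölder's inequality for the integrand of `b`, with exponents `4`, `2`, `4`. -/
lemma eLpNorm_triIntegrand_le (θ ψ φ : VKappa Ω ΓD) :
    eLpNorm (triIntegrand θ ψ φ) 1 (volume.restrict Ω) ≤
      eLpNorm θ.toLKappa.fn 4 (volume.restrict Ω) * eLpNorm φ.toLKappa.fn 4 (volume.restrict Ω) *
        eLpNorm ψ.grad 2 (volume.restrict Ω) := by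
  have hθ := Lp.aestronglyMeasurable θ.toLKappa.fn
  have hφ := Lp.aestronglyMeasurable φ.toLKappa.fn
  have hψ := Lp.aestronglyMeasurable ψ.grad
  have : ENNReal.HolderTriple 4 4 2 := ⟨by
    rw [← two_mul, show (4 : ENNReal) = 2 * 2 by norm_num,
      ENNReal.mul_inv (by norm_num) (by norm_num), ← mul_assoc,
      ENNReal.mul_inv_cancel (by norm_num) (by norm_num), one_mul]⟩
  have h1 := eLpNorm_smul_le_mul_eLpNorm (p := 4) (q := 4) (r := 2) hφ.norm hθ.norm
  have h2 := eLpNorm_smul_le_mul_eLpNorm (p := 2) (q := 2) (r := 1) hψ.norm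
    (hθ.norm.smul hφ.norm)
  rw [eLpNorm_norm, eLpNorm_norm] at h1
  rw [eLpNorm_norm] at h2
  refine le_trans (eLpNorm_mono fun x => ?_) (h2.trans (mul_le_mul_left h1 _))
  simp only [Pi.smul_apply', Pi.mul_apply, smul_eq_mul, norm_mul, norm_norm]
  exact abs_sum_mul_le _ _ _

lemma triIntegrand_integrable {θ φ : VKappa Ω ΓD} (ψ : VKappa Ω ΓD)
    (hθ : MemLp θ.toLKappa.fn 4 (volume.restrict Ω))
    (hφ : MemLp φ.toLKappa.fn 4 (volume.restrict Ω)) :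
    Integrable (triIntegrand θ ψ φ) (volume.restrict Ω) := by
  rw [← memLp_one_iff_integrable]
  exact ⟨aestronglyMeasurable_triIntegrand θ ψ φ, (eLpNorm_triIntegrand_le θ ψ φ).trans_lt
    (ENNReal.mul_lt_top (ENNReal.mul_lt_top hθ.2 hφ.2) (Lp.memLp ψ.grad).2)⟩

lemma abs_triForm_le {θ φ : VKappa Ω ΓD} (ψ : VKappa Ω ΓD)
    (hθ : MemLp θ.toLKappa.fn 4 (volume.restrict Ω))
    (hφ : MemLp φ.toLKappa.fn 4 (volume.restrict Ω)) :
    |triForm θ ψ φ| ≤ θ.normFour * φ.normFour * ‖ψ.grad‖ := by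
  have h1 : ‖triForm θ ψ φ‖ₑ ≤ eLpNorm (triIntegrand θ ψ φ) 1 (volume.restrict Ω) := by
    rw [eLpNorm_one_eq_lintegral_enorm]
    exact enorm_integral_le_lintegral_enorm _
  have h2 := ENNReal.toReal_mono (ENNReal.mul_lt_top (ENNReal.mul_lt_top hθ.2 hφ.2)
    (Lp.memLp ψ.grad).2).ne (h1.trans (eLpNorm_triIntegrand_le θ ψ φ))
  rwa [toReal_enorm, ENNReal.toReal_mul, ENNReal.toReal_mul] at h2

lemma triForm_sub_left {θ θ' φ : VKappa Ω ΓD} (ψ : VKappa Ω ΓD)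
    (hθ : MemLp θ.toLKappa.fn 4 (volume.restrict Ω))
    (hθ' : MemLp θ'.toLKappa.fn 4 (volume.restrict Ω))
    (hφ : MemLp φ.toLKappa.fn 4 (volume.restrict Ω)) :
    triForm (θ - θ') ψ φ = triForm θ ψ φ - triForm θ' ψ φ := by
  refine Eq.trans ?_ (integral_sub (triIntegrand_integrable ψ hθ hφ)
    (triIntegrand_integrable ψ hθ' hφ))
  refine integral_congr_ae ?_
  filter_upwards [Lp.coeFn_sub θ.toLKappa.fn θ'.toLKappa.fn] with x hx
  simp only [map_sub, hx, Pi.sub_apply, PiLp.sub_apply, Fin.sum_univ_two]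
  ring

lemma triForm_sub_middle {θ φ : VKappa Ω ΓD} (ψ ψ' : VKappa Ω ΓD)
    (hθ : MemLp θ.toLKappa.fn 4 (volume.restrict Ω))
    (hφ : MemLp φ.toLKappa.fn 4 (volume.restrict Ω)) :
    triForm θ (ψ - ψ') φ = triForm θ ψ φ - triForm θ ψ' φ := by
  refine Eq.trans ?_ (integral_sub (triIntegrand_integrable ψ hθ hφ)
    (triIntegrand_integrable ψ' hθ hφ))
  refine integral_congr_ae ?_
  filter_upwards [Lp.coeFn_sub ψ.grad ψ'.grad] with x hx
  simp only [map_sub, hx, Pi.sub_apply, PiLp.sub_apply, Fin.sum_univ_two]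
  ring

/-- The convective terms are absorbed by the gradient term: `U` bounds the `W^{1,2}` norm of `u`,
and what remains is a multiple of `‖w‖²`. -/
lemma neg_triForm_le {C : ℝ} (hC : 0 ≤ C) (hLad : ∀ v : VKappa Ω ΓD,
      MemLp v.toLKappa.fn 4 (volume.restrict Ω) ∧
        v.normFour ^ 2 ≤ C * (‖v.toLKappa‖ * (‖v.toLKappa‖ + ‖v.grad‖)))
    (u w : VKappa Ω ΓD) {U : ℝ} (hU : ‖u.toLKappa‖ + ‖u.grad‖ ≤ U) :
    -(triForm u w w + triForm w u w) ≤
      ‖w.grad‖ ^ 2 + (3 + 4 * (C * U) ^ 4) * ‖w.toLKappa‖ ^ 2 := by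
  have h1 := abs_triForm_le w (hLad u).1 (hLad w).1
  have h2 := abs_triForm_le u (hLad w).1 (hLad w).1
  have hu := (hLad u).2
  have hw := (hLad w).2
  have ha := norm_nonneg w.toLKappa
  have hd := norm_nonneg w.grad
  have hau := norm_nonneg u.toLKappa
  have hdu := norm_nonneg u.grad
  have hx := u.normFour_nonneg
  have hy := w.normFour_nonneg
  generalize ‖w.toLKappa‖ = a at *
  generalize ‖w.grad‖ = d at *
  generalize ‖u.toLKappa‖ = au at *
  generalize ‖u.grad‖ = du at *
  generalize u.normFour = x at *
  generalize w.normFour = y at *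
  have hUnn : 0 ≤ U := by linarith
  have hq : 0 ≤ C * U := mul_nonneg hC hUnn
  have e1 : x ^ 2 ≤ C * (U * U) := hu.trans
    (mul_le_mul_of_nonneg_left (mul_le_mul (by linarith) hU (by linarith) hUnn) hC)
  have e2 : y * y * du ≤ (C * U) * (a * (a + d)) := by
    have : y * y * du ≤ C * (a * (a + d)) * U := by
      rw [← pow_two]
      exact mul_le_mul hw (by linarith) hdu (by positivity)
    linarith
  have e3 : (x * y) ^ 2 ≤ (C * U) ^ 2 * (a * (a + d)) := by
    have : x ^ 2 * y ^ 2 ≤ (C * (U * U)) * (C * (a * (a + d))) :=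
      mul_le_mul e1 hw (by positivity) (by positivity)
    nlinarith
  -- Young's inequality, with weights chosen so that the three resulting multiples of `d ^ 2` sum to
  -- less than one.
  have e4 : x * y * d ≤ d ^ 2 / 4 + (x * y) ^ 2 := by nlinarith [sq_nonneg (d / 2 - x * y)]
  have t1 := neg_abs_le (triForm u w w)
  have t2 := neg_abs_le (triForm w u w)
  generalize C * U = q at *
  have e5 : q * (a * d) ≤ d ^ 2 / 4 + q ^ 2 * a ^ 2 := by nlinarith [sq_nonneg (d / 2 - q * a)]
  have e6 : q ^ 2 * (a * d) ≤ d ^ 2 / 4 + q ^ 4 * a ^ 2 := by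
    nlinarith [sq_nonneg (d / 2 - q ^ 2 * a)]
  have e7 : q ≤ 1 + q ^ 4 := by nlinarith [sq_nonneg (q ^ 2 - 1 / 2), sq_nonneg (q - 1 / 2)]
  have e8 : q ^ 2 ≤ 1 + q ^ 4 := by nlinarith [sq_nonneg (q ^ 2 - 1)]
  have e9 := mul_le_mul_of_nonneg_right e7 (sq_nonneg a)
  have e10 := mul_le_mul_of_nonneg_right e8 (sq_nonneg a)
  nlinarith [sq_nonneg d]

/-! ### The space `X` and injectivity of the linearized operator -/

variable {T : ℝ}

/-- On `𝒟` the `W^{1,2}` norm is controlled by `‖∇w‖² = (f, w) ≤ ‖f‖ ‖w‖`. -/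
lemma DSpace.norm_grad_sq_le (p : DSpace Ω ΓD) :
    ‖p.toVKappa.grad‖ ^ 2 ≤ ‖p‖ * ‖p.toVKappa.toLKappa‖ := by
  have h1 := p.2 p.toVKappa
  rw [gradInner_eq] at h1
  rw [← real_inner_self_eq_norm_sq]
  refine (le_of_eq h1).trans ((real_inner_le_norm _ _).trans ?_)
  exact mul_le_mul_of_nonneg_right (norm_snd_le p.1) (norm_nonneg _)

lemma DSpace.eq_zero_of_toVKappa (hb : Bornology.IsBounded Ω) {p : DSpace Ω ΓD}
    (hp : p.toVKappa = 0) : p = 0 := by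
  refine Subtype.ext (Prod.ext hp (LKappa.eq_zero_of_orthogonal hb _ fun v => ?_))
  refine (p.2 v).symm.trans ?_
  rw [gradInner_eq, show p.1.1 = 0 from hp, map_zero, inner_zero_left]

lemma XSpace.hasTimeDeriv (w : XSpace Ω ΓD T) : HasTimeDeriv w.1 w.deriv w.init :=
  w.2.choose_spec.choose_spec

/-- Elements of `X` are bounded in `L²(Ω)²`, uniformly in time. -/
lemma XSpace.exists_norm_toLKappa_le (w : XSpace Ω ΓD T) :
    ∃ R : ℝ, 0 ≤ R ∧ ∀ᵐ t ∂timeMeasure T, ‖(w.val t).toLKappa‖ ≤ R := by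
  have hi : Integrable (fun s => w.deriv s) (timeMeasure T) :=
    (Lp.memLp w.deriv).integrable (by norm_num)
  refine ⟨‖w.init‖ + ∫ s in Ioo 0 T, ‖w.deriv s‖,
    add_nonneg (norm_nonneg _) (integral_nonneg fun _ => norm_nonneg _), ?_⟩
  filter_upwards [w.hasTimeDeriv, ae_restrict_mem measurableSet_Ioo] with t h1 ht
  rw [XSpace.val, h1]
  refine (norm_add_le _ _).trans (add_le_add_right ((norm_integral_le_integral_norm _).trans ?_) _)
  exact setIntegral_mono_set hi.norm (Filter.Eventually.of_forall fun s => norm_nonneg _)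
    (Ioo_subset_Ioo_right ht.2.le).eventuallyLE

/-- The `W^{1,2}` norm of an element of `X` lies in `L⁴(0, T)`, since `‖∇u‖² ≤ ‖f‖ ‖u‖` with
`f ∈ L²(0, T; L²_κ)` and `u` bounded in `L²(Ω)²`. -/
lemma XSpace.exists_integrable_pow_four (u : XSpace Ω ΓD T) :
    ∃ h : ℝ → ℝ, Integrable h (timeMeasure T) ∧ ∀ᵐ t ∂timeMeasure T,
      (‖(u.val t).toLKappa‖ + ‖(u.val t).grad‖) ^ 4 ≤ h t := by
  obtain ⟨R, hR, hu⟩ := u.exists_norm_toLKappa_le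
  have hint : Integrable (fun t => ‖u.1 t‖ ^ 2) (timeMeasure T) :=
    (memLp_two_iff_integrable_sq_norm (Lp.aestronglyMeasurable u.1)).1 (Lp.memLp u.1)
  refine ⟨fun t => 8 * R ^ 4 + 8 * R ^ 2 * ‖u.1 t‖ ^ 2,
    (integrable_const _).add (hint.const_mul _), ?_⟩
  filter_upwards [hu] with t ht
  have h1 := DSpace.norm_grad_sq_le (u.1 t)
  change ‖(u.val t).grad‖ ^ 2 ≤ ‖u.1 t‖ * ‖(u.val t).toLKappa‖ at h1
  have ha := norm_nonneg (u.val t).toLKappa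
  have hd := norm_nonneg (u.val t).grad
  have hf := norm_nonneg (u.1 t)
  generalize ‖(u.val t).toLKappa‖ = a at *
  generalize ‖(u.val t).grad‖ = d at *
  generalize ‖u.1 t‖ = f at *
  have h2 : d ^ 2 ≤ f * R := h1.trans (mul_le_mul_of_nonneg_left ht hf)
  have h3 : (d ^ 2) ^ 2 ≤ (f * R) ^ 2 := pow_le_pow_left₀ (sq_nonneg d) h2 2
  have h4 : a ^ 4 ≤ R ^ 4 := pow_le_pow_left₀ ha ht 4
  have h5 : (a + d) ^ 4 ≤ 8 * (a ^ 4 + d ^ 4) := by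
    have := add_pow_le ha hd 4
    norm_num at this
    exact this
  nlinarith

/-- `𝓖_u` is injective: the difference `w` of two solutions satisfies the linear problem with zero
data, so testing with `w(t)` gives `(w', w) ≤ h ‖w‖²` with an integrable function `h`. -/
lemma linearizedOp_injective {ΓN : Set Plane} (hΩ : IsMixedDomain Ω ΓD ΓN) (u : XSpace Ω ΓD T) :
    Function.Injective (linearizedOp u) := by
  intro w₁ w₂ heq
  obtain ⟨C, hC, hLad⟩ := exists_normFour_sq_le (ΓD := ΓD) hΩ.isOpen hΩ.isBounded hΩ.lipschitz
  obtain ⟨h, hh, hhu⟩ := u.exists_integrable_pow_four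
  obtain ⟨heq1, heq2⟩ := Prod.ext_iff.1 heq
  have hinit : w₁.init = w₂.init := by
    simpa [linearizedOp, stokesOp, convectionOp] using heq2
  have hweak : ∀ᵐ t ∂timeMeasure T, ∀ v : VKappa Ω ΓD,
      (inner ℝ (w₁.deriv t) v.toLKappa + gradInner (w₁.val t) v) +
        (triForm (u.val t) (w₁.val t) v + triForm (w₁.val t) (u.val t) v) =
      (inner ℝ (w₂.deriv t) v.toLKappa + gradInner (w₂.val t) v) +
        (triForm (u.val t) (w₂.val t) v + triForm (w₂.val t) (u.val t) v) :=
    (Filter.Germ.coe_eq.1 heq1).mono fun t ht v => congrFun ht v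
  -- `k` is the time derivative of the difference, extended by zero to the real line.
  set k : ℝ → LKappa Ω ΓD := (Ioo 0 T).indicator fun s => w₁.deriv s - w₂.deriv s with hk
  have hi₁ : Integrable (fun s => w₁.deriv s) (timeMeasure T) :=
    (Lp.memLp w₁.deriv).integrable (by norm_num)
  have hi₂ : Integrable (fun s => w₂.deriv s) (timeMeasure T) :=
    (Lp.memLp w₂.deriv).integrable (by norm_num)
  have hki : Integrable k := (integrable_indicator_iff measurableSet_Ioo).2 (hi₁.sub hi₂)
  have hW : ∀ᵐ t ∂timeMeasure T,
      ∫ s in (0 : ℝ)..t, k s = (w₁.val t - w₂.val t).toLKappa := by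
    filter_upwards [w₁.hasTimeDeriv, w₂.hasTimeDeriv, ae_restrict_mem measurableSet_Ioo]
      with t h1 h2 ht
    have h3 : ∫ s in (0 : ℝ)..t, k s = ∫ s in Ioo 0 t, (w₁.deriv s - w₂.deriv s) := by
      rw [intervalIntegral.integral_of_le ht.1.le, integral_Ioc_eq_integral_Ioo]
      refine setIntegral_congr_fun measurableSet_Ioo fun s hs => ?_
      exact indicator_of_mem (show s ∈ Ioo 0 T from ⟨hs.1, hs.2.trans ht.2⟩) _
    rw [h3, integral_sub (integrableOn_time ht w₁.deriv) (integrableOn_time ht w₂.deriv), map_sub,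
      XSpace.val, XSpace.val, h1, h2, hinit]
    abel
  have hle : ∀ᵐ t ∂timeMeasure T, inner ℝ (k t) (∫ s in (0 : ℝ)..t, k s) ≤
      (3 + 4 * C ^ 4 * h t) * ‖∫ s in (0 : ℝ)..t, k s‖ ^ 2 := by
    filter_upwards [hW, hweak, hhu, ae_restrict_mem measurableSet_Ioo] with t h1 h2 h3 ht
    rw [h1, hk, indicator_of_mem ht]
    have h4 := h2 (w₁.val t - w₂.val t)
    have h5 := neg_triForm_le hC hLad (u.val t) (w₁.val t - w₂.val t) le_rfl
    rw [triForm_sub_middle _ _ (hLad _).1 (hLad _).1, triForm_sub_left _ (hLad _).1 (hLad _).1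
      (hLad _).1] at h5
    have h6 : gradInner (w₁.val t) (w₁.val t - w₂.val t) -
        gradInner (w₂.val t) (w₁.val t - w₂.val t) = ‖(w₁.val t - w₂.val t).grad‖ ^ 2 := by
      rw [gradInner_eq, gradInner_eq, ← inner_sub_left, ← map_sub, real_inner_self_eq_norm_sq]
    rw [inner_sub_left]
    have h7 : (C * (‖(u.val t).toLKappa‖ + ‖(u.val t).grad‖)) ^ 4 ≤ C ^ 4 * h t := by
      rw [mul_pow]
      exact mul_le_mul_of_nonneg_left h3 (by positivity)
    have h8 := mul_le_mul_of_nonneg_right h7 (sq_nonneg ‖(w₁.val t - w₂.val t).toLKappa‖)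
    linarith
  have hhT : Integrable (fun t => 3 + 4 * C ^ 4 * h t) (timeMeasure T) :=
    (integrable_const _).add (hh.const_mul _)
  have hzero : ∀ t ∈ Icc 0 T, ∫ s in (0 : ℝ)..t, k s = 0 := by
    refine fun t ht => primitive_eq_zero_of_inner_le hki
      ((integrable_indicator_iff measurableSet_Ioo).2 hhT) ?_ ht
    filter_upwards [(ae_restrict_iff' measurableSet_Ioo).1 hle] with s hs hsT
    rw [indicator_of_mem hsT]
    exact hs hsT
  refine Subtype.ext (Lp.ext ?_)
  filter_upwards [hW, ae_restrict_mem measurableSet_Ioo] with t h1 ht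
  rw [hzero t ⟨ht.1.le, ht.2.le⟩] at h1
  have h2 : (w₁.1 t - w₂.1 t).toVKappa = 0 := by
    rw [map_sub]
    exact VKappa.toLKappa_injective hΩ.isOpen (h1.symm.trans (map_zero _).symm)
  exact sub_eq_zero.1 (DSpace.eq_zero_of_toVKappa hΩ.isBounded h2)

end MixedNS

end

theorem mainTheorem7 {Ω ΓD ΓN : Set MixedNS.Plane} (hΩ : MixedNS.IsMixedDomain Ω ΓD ΓN)
    {T : ℝ} (hT : 0 < T) (u : MixedNS.XSpace Ω ΓD T) :
    Function.Injective (MixedNS.linearizedOp u) ∧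
      ∀ G : MixedNS.XSpace Ω ΓD T → MixedNS.YSpace Ω ΓD T,
        (∀ w, MixedNS.YSpace.toData (G w) = MixedNS.linearizedOp u w) → Function.Injective G := by
  have hinj := MixedNS.linearizedOp_injective hΩ u
  refine ⟨hinj, fun G hG w₁ w₂ h => hinj ?_⟩
  rw [← hG, ← hG, h]
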